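/- **Proposition 5.4.** Notation. Let $n=d+m$, let $\mathbb B=\mathbb B(1)$ be the open unit ball of $\mathbb C^n$, with coordinates $z_j=x_j+\sqrt{-1}\,y_j$ and the standard Hermitian metric. For an open set $U$ and a map $\varphi$ on $U$, $|\varphi|_{U,k}\in[0,\infty]$ is the $C^k$ norm: the supremum over $U$ of the operator norms of the real derivatives of $\varphi$ of order at most $k$ (it is $\infty$ if $\varphi\notin C^k(U)$), and $|\varphi|_k=|\varphi|_{\mathbb B,k}$; for a finite family, $|\rho|_k=\max_l|\rho_l|_k$. In products and sums of norms, $0\cdot\infty=0$. Let $M$ be the zero set of real functions $\rho=(\rho_1,\dots,\rho_m)$. Then $\mathbb CT(M)$ consists of the complex tangent vectors $X=\sum a_i\,\partial/\partial z_i+\sum b_i\,\partial/\partial\bar z_i$ at points of $M$ with $d\rho_l(X)=0$ for all $l$; $T'(M)=T'(\mathbb C^n)\cap\mathbb CT(M)$, $T''(M)=T''(\mathbb C^n)\cap\mathbb CT(M)$, where $T'(\mathbb C^n)$ and $T''(\mathbb C^n)$ are spanned by the $\partial/\partial z_i$ and by the $\partial/\partial\bar z_i$; $\mathbf N$ is the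 orthogonal complement of $T'(M)\oplus T''(M)$ in $\mathbb CT(M)$; and $\tau:T'(\mathbb C^n)\to T'(M)\oplus\mathbf N$ is the inverse of the restriction to $T'(M)\oplus\mathbf N$ of the projection to $T'(\mathbb C^n)$ along $T''(\mathbb C^n)$. A $T'(\mathbb C^n)$-valued $(0,1)$-form on $M$ is given by a function $\mu$ with values in the complex $n\times n$ matrices ($\mu$ sends $\sum b_j\,\partial/\partial\bar z_j$ to $\sum_i(\mu b)_i\,\partial/\partial z_i$); two such functions represent the same form on $M$ if they agree on $T''(M)$. A representative is called normalized on $M$ if at the points of $M$ it vanishes on the orthogonal complement of $T''(M)$ in $T''(\mathbb C^n)$. Put $$T''_\mu(M)=\{Z-\tau(\mu(Z)):Z\in T''(M)\}.$$ For $f=(f_1,\dots,f_n)$, $\bar\partial_M f$ is the form $Z\mapsto\sum_i Z(f_i)\,\partial/\partial z_i$ on $T''(M)$. Statement. For every $d,m\ge 0$ there is a polynomial $P$ with natural coefficients such that for every integer $k\ge2$ there are $\delta>0$, $\epsilon>0$ and a constant $C(k)$ with the following property. Let $s,p$ be integers with $2\le s\le k$ and $k+s<p$. Let $$\rho_l(z)=y_{n-m+l}+r_l(z)\quad(l=1,\dots,m),$$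 where the $r_l\in C^p(\mathbb B)$ are real-valued with $|r_l|_1<\delta$, and let $M=\{z\in\mathbb B:\rho_1(z)=\dots=\rho_m(z)=0\}$. Let $\mu\in C^p(\mathbb B)$ be a matrix function as above with $|\mu|_k<\epsilon$, let $f\in C^p(\mathbb B,\mathbb C^n)$ with $|f|_{k+1}<\epsilon$, and let $F(z)=z+f(z)$. Then: 1. $F$ is injective on $\mathbb B$, $F(\mathbb B)$ is open and $F^{-1}\in C^p(F(\mathbb B))$; so $M^*=F(M)$ is defined in $F(\mathbb B)$ by the functions $\rho_l^*=\rho_l\circ F^{-1}$. 2. There is a form $\mu^*$ on $M^*$, with coefficients in $C^{p-1}(F(\mathbb B))$, such that $$DF[T''_\mu(M)]=T''_{\mu^*}(M^*).$$ 3. Let $\mu^*$ be any form on $M^*$ with this property, and let $q$ be any matrix function on $\mathbb B$ that represents the form $\bar\partial_M f-\mu$ on $M$. Then $\mu^*$ has a representative $\nu$ on $F(\mathbb B)$, normalized on $M^*$, such that $$|\nu|_{F(\mathbb B),k}\le C(k)\,(1+|\rho|_{k+2}+|f|_{k+1}+|\mu|_k)^{P(k)}\,\bigl(|q|_k+|f|_{k+1}|\mu|_k\bigr),$$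 $$|\nu|_{F(\mathbb B),k+s}\le C(k)\,(1+|\rho|_{k+2}+|f|_{k+1}+|\mu|_k)^{P(k)}\Bigl\{|q|_{k+s}+|f|_{k+s+1}|\mu|_k+|f|_{k+1}|\mu|_{k+s}+(1+|\rho|_{k+s+2}+|f|_{k+s+1}+|\mu|_{k+s})\bigl(|q|_k+|f|_{k+1}|\mu|_k\bigr)\Bigr\}.$$ -/

import Mathlib

open scoped ENNReal NNReal
open Metric

noncomputable section

/-- The Hermitian space `ℂⁿ`. -/
abbrev Cn (n : ℕ) := EuclideanSpace ℂ (Fin n)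

/-- The complexified tangent space of `ℂⁿ` at a point, with its standard Hermitian product:
`X` stands for `∑ i, (X.fst i) ∂/∂z_i + ∑ i, (X.snd i) ∂/∂z̄_i`. -/
abbrev CTan (n : ℕ) := WithLp 2 (Cn n × Cn n)

/-- The `C^k` norm `|φ|_k` on an open set `U`: the supremum over `U` of the (operator) norms of the
real derivatives of order at most `k`; it is `∞` if `φ` is not of class `C^k` on `U`. -/
def ckNorm {E V : Type*} [NormedAddCommGroup E] [NormedSpace ℝ E]
    [NormedAddCommGroup V] [NormedSpace ℝ V] (U : Set E) (k : ℕ) (φ : E → V) : ℝ≥0∞ :=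
  open Classical in
  if ContDiffOn ℝ k φ U then ⨆ z ∈ U, ⨆ j ≤ k, ‖iteratedFDeriv ℝ j φ z‖ₑ else ⊤

/-- `|ρ|_k`, the maximum of `|ρ_l|_k` over a finite family of functions. -/
def ckNormFam {m : ℕ} {E V : Type*} [NormedAddCommGroup E] [NormedSpace ℝ E]
    [NormedAddCommGroup V] [NormedSpace ℝ V] (U : Set E) (k : ℕ) (φ : Fin m → E → V) : ℝ≥0∞ :=
  ⨆ l, ckNorm U k (φ l)

section Wirtinger

variable {n : ℕ} {V : Type*} [NormedAddCommGroup V] [NormedSpace ℂ V]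

/-- `∂φ/∂z_i = (∂φ/∂x_i - √-1 ∂φ/∂y_i) / 2`. -/
def wirtinger (φ : Cn n → V) (z : Cn n) (i : Fin n) : V :=
  (1 / 2 : ℂ) • (fderiv ℝ φ z (EuclideanSpace.single i 1)
    - Complex.I • fderiv ℝ φ z (EuclideanSpace.single i Complex.I))

/-- `∂φ/∂z̄_i = (∂φ/∂x_i + √-1 ∂φ/∂y_i) / 2`. -/
def wirtingerBar (φ : Cn n → V) (z : Cn n) (i : Fin n) : V :=
  (1 / 2 : ℂ) • (fderiv ℝ φ z (EuclideanSpace.single i 1)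
    + Complex.I • fderiv ℝ φ z (EuclideanSpace.single i Complex.I))

/-- The complexified differential of `φ` at `z`: the derivative `X(φ)` of `φ` along `X`. -/
def cdiff (φ : Cn n → V) (z : Cn n) : CTan n →ₗ[ℂ] V where
  toFun X := (∑ i, X.fst i • wirtinger φ z i) + ∑ i, X.snd i • wirtingerBar φ z i
  map_add' X Y := by
    simp only [WithLp.add_fst, WithLp.add_snd, PiLp.add_apply, add_smul, Finset.sum_add_distrib]
    abel
  map_smul' c X := by
    simp only [WithLp.smul_fst, WithLp.smul_snd, PiLp.smul_apply, smul_eq_mul, mul_smul,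
      Finset.smul_sum, smul_add, RingHom.id_apply]

end Wirtinger

section CRStructures

variable {n m : ℕ}

/-- Coordinatewise complex conjugation on `ℂⁿ`. -/
def conjCn (v : Cn n) : Cn n := WithLp.toLp 2 fun i => star (v i)

/-- The complexified differential `DF` of a map `F` at `z`: the components of `DF(X)` along
`∂/∂z_s` and `∂/∂z̄_s` are `X(F_s)` and `X(F̄_s)`. -/
def pushCT (F : Cn n → Cn n) (z : Cn n) (X : CTan n) : CTan n :=
  WithLp.toLp 2 (cdiff F z X, cdiff (fun w => conjCn (F w)) z X)

/-- `T'(ℂⁿ)`, the span of the `∂/∂z_i`. -/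
def T10 (n : ℕ) : Submodule ℂ (CTan n) where
  carrier := {X | X.snd = 0}
  add_mem' {X Y} hX hY := by
    simp only [Set.mem_ofPred_eq] at *
    simp [hX, hY]
  zero_mem' := by simp
  smul_mem' c X hX := by
    simp only [Set.mem_ofPred_eq] at *
    simp [hX]

/-- `T''(ℂⁿ)`, the span of the `∂/∂z̄_i`. -/
def T01 (n : ℕ) : Submodule ℂ (CTan n) where
  carrier := {X | X.fst = 0}
  add_mem' {X Y} hX hY := by
    simp only [Set.mem_ofPred_eq] at *
    simp [hX, hY]
  zero_mem' := by simp
  smul_mem' c X hX := by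
    simp only [Set.mem_ofPred_eq] at *
    simp [hX]

/-- The complexified tangent space at `z` of the manifold with defining functions `ρ`. -/
def ctM (ρ : Fin m → Cn n → ℝ) (z : Cn n) : Submodule ℂ (CTan n) :=
  ⨅ l, LinearMap.ker (cdiff (fun w => (ρ l w : ℂ)) z)

/-- `T'(M) = T'(ℂⁿ) ∩ ℂT(M)`. -/
def t10M (ρ : Fin m → Cn n → ℝ) (z : Cn n) : Submodule ℂ (CTan n) := T10 n ⊓ ctM ρ z

/-- `T''(M) = T''(ℂⁿ) ∩ ℂT(M)`. -/
def t01M (ρ : Fin m → Cn n → ℝ) (z : Cn n) : Submodule ℂ (CTan n) := T01 n ⊓ ctM ρ z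

/-- `N`, the orthogonal complement of `T'(M) ⊕ T''(M)` in `ℂT(M)`. -/
def nM (ρ : Fin m → Cn n → ℝ) (z : Cn n) : Submodule ℂ (CTan n) :=
  ctM ρ z ⊓ (t10M ρ z ⊔ t01M ρ z)ᗮ

/-- A `T'(ℂⁿ)`-valued `(0,1)`-form, given by its coefficient matrix: at `z` it sends
`∑ j, b_j ∂/∂z̄_j` to `∑ i, (ω z b)_i ∂/∂z_i`. -/
abbrev Form01 (n : ℕ) := Cn n → (Cn n →L[ℂ] Cn n)

/-- The fibre at `z` of `T''_μ(M) = {Z - τ(μ(Z)) : Z ∈ T''(M)}`. Here `τ : T'(ℂⁿ) → T'(M) ⊕ N` is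
the inverse of the restriction to `T'(M) ⊕ N` of the projection to `T'(ℂⁿ)` along `T''(ℂⁿ)`, so
that `Y = τ(μ(Z))` means: `Y ∈ T'(M) ⊕ N` and the `T'`-component of `Y` is `μ(Z)`. -/
def almostCR (ρ : Fin m → Cn n → ℝ) (μ : Form01 n) (z : Cn n) : Set (CTan n) :=
  {X | ∃ Z ∈ t01M ρ z, ∃ Y ∈ t10M ρ z ⊔ nM ρ z, Y.fst = μ z Z.snd ∧ X = Z - Y}

/-- `ω` and `ν` define the same form on the part `S` of the manifold with defining functions `ρ`:
they agree on `T''(M)` at the points of `S`. -/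
def SameForm (ρ : Fin m → Cn n → ℝ) (S : Set (Cn n)) (ω ν : Form01 n) : Prop :=
  ∀ z ∈ S, ∀ Z ∈ t01M ρ z, ω z Z.snd = ν z Z.snd

/-- The coefficient matrix `ν` is normalized on `S`: it annihilates the vectors of `T''(ℂⁿ)` that
are orthogonal to `T''(M)`. The values of `ν` on `S` are then determined by the form on the
manifold. -/
def IsNormalized (ρ : Fin m → Cn n → ℝ) (S : Set (Cn n)) (ν : Form01 n) : Prop :=
  ∀ z ∈ S, ∀ Z ∈ T01 n ⊓ (t01M ρ z)ᗮ, ν z Z.snd = 0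

/-- The matrix function `q` represents the form `∂̄_M f - μ` on `S`, where `∂̄_M f` is the form
`Z ↦ Z(f)` on `T''(M)` and `f = (f_1, …, f_n)` is read as the section `∑ f_i ∂/∂z_i`. -/
def RepresentsDbarSub (ρ : Fin m → Cn n → ℝ) (S : Set (Cn n)) (f : Cn n → Cn n) (μ q : Form01 n) :
    Prop :=
  ∀ z ∈ S, ∀ Z ∈ t01M ρ z, q z Z.snd = cdiff f z Z - μ z Z.snd

/-- `ρ_l(z) = y_{n-m+l} + r_l(z)`, with `n = d + m`. -/
def graphDef (d : ℕ) {m : ℕ} (r : Fin m → Cn (d + m) → ℝ) (l : Fin m) (z : Cn (d + m)) : ℝ :=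
  (z (Fin.natAdd d l)).im + r l z

/-- The common zero set in `U` of the functions `ρ`. -/
def zeroLocus (U : Set (Cn n)) (ρ : Fin m → Cn n → ℝ) : Set (Cn n) := {z ∈ U | ∀ l, ρ l z = 0}

/-- The defining functions `ρ*_l = ρ_l ∘ F⁻¹` of the image under `F`, where `F` is injective on
`U`. -/
def pushDef (U : Set (Cn n)) (F : Cn n → Cn n) (ρ : Fin m → Cn n → ℝ) (l : Fin m) (w : Cn n) : ℝ :=
  ρ l (Function.invFunOn F U w)

/-- `DF[T''_μ(M)] = T''_{μ*}(F(M))`, where `M` is the zero set of `ρ` in `U`. -/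
def PushesTo (U : Set (Cn n)) (F : Cn n → Cn n) (ρ : Fin m → Cn n → ℝ) (μ μs : Form01 n) : Prop :=
  ∀ z ∈ zeroLocus U ρ,
    pushCT F z '' almostCR ρ μ z = almostCR (pushDef U F ρ) μs (F z)

end CRStructures

end

/-! The proof is linear algebra at each point, followed by one weighted estimate. At a point of M
let T be the differential of ρ, T' = `holPart T`, R = `antiPart T`, and let D be the differential of
f. Then T''(M) is the kernel of R, and T'(M) ⊕ N is the orthogonal complement of T''(M) in ℂT(M).
Hence τ(a) has ∂/∂z̄-part -J T' a with J = R†(RR†)⁻¹, and the fibre of T''_μ(M) consists of the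
vectors (-μb, b + J T' μb) with Rb = 0 (`mem_almostCR_iff`).

Under DF such a vector gets ∂/∂z-part qb plus a term bilinear in D and μ (`holImage`): the linear
terms combine into ∂̄f - μ = q. Its ∂/∂z̄-part, projected onto T''(M*), is (1+E)b with E =
`frameErr`. The operator E is arranged so that R*(1+E) = R on all of ℂⁿ, where R* is the analogue of
R for M*. As E is small, 1+E is invertible and maps T''(M) onto T''(M*). So μ* is forced on T''(M*)
(`image_almostCR_iff`), and composing with the orthogonal projection onto T''(M*) gives the
normalized matrix `imageForm`; ν is its composition with F⁻¹. The map F is the identity plus a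
1/2-Lipschitz map, hence a diffeomorphism onto an open set.

For the estimates, let K and L be the sums 1 + |ρ| + |f| + |μ| of low and of high norms. Derivatives
of order j of the auxiliary operators are O(K^j) for j ≤ k and O(K^j L) for k < j ≤ k+s. Since s ≤
k, two factors of a product never both carry more than k derivatives, so the weights are
submultiplicative (`tameWeight_mul_le`). The bounds therefore survive products, inverses
(`TameBound.of_fixedPoint`) and composition with F⁻¹ (`TameBound.comp`). Order zero is bounded by
absolute constants, so the exponent of K counts derivatives and not factors, whence P(k) = 2k. Each
term of `holImage` contains either q or a pair D, μ, which gives the linear sizes on the right-hand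
side. Constants are uniform because the bounds are proved for the family of all admissible data at
once. -/

set_option maxSynthPendingDepth 3
set_option linter.unusedSectionVars false

open scoped ENNReal NNReal
open Metric

noncomputable section

/-! ### Weighted derivative bounds, uniform over a family: linear operations and products. -/

section TameBound

variable {ι E V V₁ V₂ V₃ : Type}
  [NormedAddCommGroup E] [NormedSpace ℝ E] [NormedAddCommGroup V] [NormedSpace ℝ V]
  [NormedAddCommGroup V₁] [NormedSpace ℝ V₁] [NormedAddCommGroup V₂] [NormedSpace ℝ V₂]
  [NormedAddCommGroup V₃] [NormedSpace ℝ V₃]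

/-- The functions `u i` are of class `C^N` on `U i`, with derivatives of order `j ≤ N` bounded by
`w i j`, up to a constant that does not depend on `i`. -/
def TameBound (U : ι → Set E) (N : ℕ) (w : ι → ℕ → ℝ≥0∞) (u : ι → E → V) : Prop :=
  ∃ C : ℝ≥0, ∀ i, ContDiffOn ℝ N (u i) (U i) ∧
    ∀ j ≤ N, ∀ z ∈ U i, ‖iteratedFDeriv ℝ j (u i) z‖ₑ ≤ C * w i j

theorem enorm_iteratedFDeriv_fderiv (u : E → V) (j : ℕ) (z : E) :
    ‖iteratedFDeriv ℝ j (fderiv ℝ u) z‖ₑ = ‖iteratedFDeriv ℝ (j + 1) u z‖ₑ := by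
  rw [← ofReal_norm, norm_iteratedFDeriv_fderiv, ofReal_norm]

theorem enorm_iteratedFDeriv_zero (u : E → V) (z : E) :
    ‖iteratedFDeriv ℝ 0 u z‖ₑ = ‖u z‖ₑ := by
  rw [← ofReal_norm, norm_iteratedFDeriv_zero, ofReal_norm]

theorem enorm_eq_zero_of_eq {W : Type*} [NormedAddCommGroup W] {x : W} (h : x = 0) : ‖x‖ₑ = 0 := by
  simp [h]

theorem iteratedFDeriv_congr_of_eqOn {U : Set E} (hU : IsOpen U) {u v : E → V}
    (h : Set.EqOn u v U) (j : ℕ) {z : E} (hz : z ∈ U) :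
    iteratedFDeriv ℝ j u z = iteratedFDeriv ℝ j v z :=
  (Filter.EventuallyEq.iteratedFDeriv ℝ (Filter.eventuallyEq_of_mem (hU.mem_nhds hz) h) j).self_of_nhds

theorem enorm_iteratedFDeriv_le_of_bilinear (B : V₁ →L[ℝ] V₂ →L[ℝ] V₃) {U : Set E} (hU : IsOpen U)
    {N : ℕ} {u : E → V₁} {v : E → V₂} (hu : ContDiffOn ℝ N u U) (hv : ContDiffOn ℝ N v U)
    {j : ℕ} (hj : j ≤ N) {z : E} (hz : z ∈ U) :
    ‖iteratedFDeriv ℝ j (fun y => B (u y) (v y)) z‖ₑ ≤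
      ‖B‖ₑ * ∑ a ∈ Finset.range (j + 1), (j.choose a : ℝ≥0∞) *
        (‖iteratedFDeriv ℝ a u z‖ₑ * ‖iteratedFDeriv ℝ (j - a) v z‖ₑ) := by
  have h := B.norm_iteratedFDerivWithin_le_of_bilinear hu hv hU.uniqueDiffOn hz
    (n := j) (by exact_mod_cast hj)
  simp only [iteratedFDerivWithin_of_isOpen _ hU hz] at h
  rw [← ofReal_norm]
  refine (ENNReal.ofReal_le_ofReal h).trans (le_of_eq ?_)
  rw [ENNReal.ofReal_mul (by positivity), ofReal_norm B,
    ENNReal.ofReal_sum_of_nonneg (fun _ _ => by positivity)]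
  congr 1
  refine Finset.sum_congr rfl fun a _ => ?_
  rw [mul_assoc, ENNReal.ofReal_mul (by positivity), ENNReal.ofReal_mul (norm_nonneg _),
    ofReal_norm, ofReal_norm, ENNReal.ofReal_natCast]

variable {U : ι → Set E} {N : ℕ} {w w₁ w₂ w₃ : ι → ℕ → ℝ≥0∞}

theorem TameBound.contDiffOn {u : ι → E → V} (h : TameBound U N w u) (i : ι) :
    ContDiffOn ℝ N (u i) (U i) := h.choose_spec i |>.1

theorem TameBound.congr (hU : ∀ i, IsOpen (U i)) {u v : ι → E → V} (h : TameBound U N w u)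
    (huv : ∀ i, Set.EqOn (v i) (u i) (U i)) : TameBound U N w v := by
  obtain ⟨C, hC⟩ := h
  refine ⟨C, fun i => ⟨(hC i).1.congr (huv i), fun j hj z hz => ?_⟩⟩
  rw [iteratedFDeriv_congr_of_eqOn (hU i) (huv i) j hz]
  exact (hC i).2 j hj z hz

theorem TameBound.mono_weight {u : ι → E → V} (h : TameBound U N w₁ u)
    (hw : ∀ i, ∀ j ≤ N, w₁ i j ≤ w₂ i j) : TameBound U N w₂ u := by
  obtain ⟨C, hC⟩ := h
  exact ⟨C, fun i => ⟨(hC i).1, fun j hj z hz =>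
    ((hC i).2 j hj z hz).trans (by gcongr; exact hw i j hj)⟩⟩

theorem TameBound.mono_order {u : ι → E → V} {M : ℕ} (h : TameBound U N w u) (hM : M ≤ N) :
    TameBound U M w u := by
  obtain ⟨C, hC⟩ := h
  exact ⟨C, fun i => ⟨(hC i).1.of_le (by exact_mod_cast hM), fun j hj z hz =>
    (hC i).2 j (hj.trans hM) z hz⟩⟩

theorem TameBound.const (hw : ∀ i, 1 ≤ w i 0) (c : V) :
    TameBound U N w (fun _ _ => c) := by
  refine ⟨‖c‖₊, fun i => ⟨contDiffOn_const, fun j hj z hz => ?_⟩⟩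
  rcases j with _ | j
  · rw [enorm_iteratedFDeriv_zero]
    simpa [enorm_eq_nnnorm] using mul_le_mul_right (hw i) (‖c‖₊ : ℝ≥0∞)
  · rw [iteratedFDeriv_const_of_ne (Nat.succ_ne_zero j), Pi.zero_apply, enorm_eq_zero_of_eq rfl]
    exact zero_le

theorem TameBound.add (hU : ∀ i, IsOpen (U i)) {u v : ι → E → V} (hu : TameBound U N w u)
    (hv : TameBound U N w v) : TameBound U N w (fun i z => u i z + v i z) := by
  obtain ⟨C, hC⟩ := hu
  obtain ⟨C', hC'⟩ := hv
  refine ⟨C + C', fun i => ⟨(hC i).1.add (hC' i).1, fun j hj z hz => ?_⟩⟩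
  have e : iteratedFDeriv ℝ j (fun z => u i z + v i z) z
      = iteratedFDeriv ℝ j (u i) z + iteratedFDeriv ℝ j (v i) z :=
    fun_iteratedFDeriv_add_apply
      (((hC i).1.contDiffAt ((hU i).mem_nhds hz)).of_le (by exact_mod_cast hj))
      (((hC' i).1.contDiffAt ((hU i).mem_nhds hz)).of_le (by exact_mod_cast hj))
  rw [e]
  refine (enorm_add_le (E := E [×j]→L[ℝ] V) _ _).trans ?_
  push_cast
  rw [add_mul]
  exact add_le_add ((hC i).2 j hj z hz) ((hC' i).2 j hj z hz)

theorem TameBound.clm (hU : ∀ i, IsOpen (U i)) (A : V₁ →L[ℝ] V₂) {u : ι → E → V₁}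
    (hu : TameBound U N w u) : TameBound U N w (fun i z => A (u i z)) := by
  obtain ⟨C, hC⟩ := hu
  refine ⟨‖A‖₊ * C, fun i => ⟨A.contDiff.comp_contDiffOn (hC i).1, fun j hj z hz => ?_⟩⟩
  have h := A.norm_iteratedFDeriv_comp_left (f := u i) (x := z) (n := j)
    ((hC i).1.contDiffAt ((hU i).mem_nhds hz)) (by exact_mod_cast hj)
  have h2 : ‖iteratedFDeriv ℝ j (fun z => A (u i z)) z‖ₑ
      ≤ ‖A‖ₑ * ‖iteratedFDeriv ℝ j (u i) z‖ₑ := by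
    rw [← ofReal_norm, ← ofReal_norm A, ← ofReal_norm (iteratedFDeriv ℝ j (u i) z),
      ← ENNReal.ofReal_mul (norm_nonneg _)]
    exact ENNReal.ofReal_le_ofReal h
  refine h2.trans ?_
  push_cast
  rw [mul_assoc]
  exact mul_le_mul_right ((hC i).2 j hj z hz) _

theorem TameBound.neg (hU : ∀ i, IsOpen (U i)) {u : ι → E → V}
    (hu : TameBound U N w u) : TameBound U N w (fun i z => - u i z) :=
  (hu.clm hU (-ContinuousLinearMap.id ℝ V))

theorem TameBound.sub (hU : ∀ i, IsOpen (U i)) {u v : ι → E → V} (hu : TameBound U N w u)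
    (hv : TameBound U N w v) : TameBound U N w (fun i z => u i z - v i z) := by
  simpa only [sub_eq_add_neg] using hu.add hU (hv.neg hU)

theorem TameBound.sum (hU : ∀ i, IsOpen (U i)) {κ : Type} (s : Finset κ) {u : κ → ι → E → V}
    (hu : ∀ l, TameBound U N w (u l)) : TameBound U N w (fun i z => ∑ l ∈ s, u l i z) := by
  classical
  induction s using Finset.induction_on with
  | empty =>
    refine ⟨0, fun i => ⟨by simpa using contDiffOn_const, fun j hj z hz => ?_⟩⟩
    simp only [Finset.sum_empty]
    rw [enorm_eq_zero_of_eq (by simp)]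
    exact zero_le
  | insert a s ha ih =>
    simp only [Finset.sum_insert ha]
    exact (hu a).add hU ih

/-- By the Leibniz rule, weights only need to be compared when `a` derivatives fall on one factor
and `b` on the other; the binomial coefficients contribute at most `2 ^ N`. -/
theorem TameBound.bilin (hU : ∀ i, IsOpen (U i)) (B : V₁ →L[ℝ] V₂ →L[ℝ] V₃)
    (hw : ∀ i a b, a + b ≤ N → w₁ i a * w₂ i b ≤ w₃ i (a + b))
    {u : ι → E → V₁} {v : ι → E → V₂} (hu : TameBound U N w₁ u) (hv : TameBound U N w₂ v) :
    TameBound U N w₃ (fun i z => B (u i z) (v i z)) := by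
  obtain ⟨C, hC⟩ := hu
  obtain ⟨C', hC'⟩ := hv
  refine ⟨‖B‖₊ * (2 ^ N * (C * C')), fun i =>
    ⟨B.isBoundedBilinearMap.contDiff.comp_contDiffOn ((hC i).1.prodMk (hC' i).1), fun j hj z hz => ?_⟩⟩
  refine (enorm_iteratedFDeriv_le_of_bilinear B (hU i) (hC i).1 (hC' i).1 hj hz).trans ?_
  have key : ∑ a ∈ Finset.range (j + 1), (j.choose a : ℝ≥0∞) *
        (‖iteratedFDeriv ℝ a (u i) z‖ₑ * ‖iteratedFDeriv ℝ (j - a) (v i) z‖ₑ)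
      ≤ ∑ a ∈ Finset.range (j + 1), (j.choose a : ℝ≥0∞) * (C * C' * w₃ i j) := by
    refine Finset.sum_le_sum fun a ha => ?_
    have ha' : a ≤ j := Nat.lt_succ_iff.mp (Finset.mem_range.mp ha)
    refine mul_le_mul_right ?_ _
    calc _ ≤ (C * w₁ i a) * (C' * w₂ i (j - a)) :=
          mul_le_mul' ((hC i).2 a (ha'.trans hj) z hz)
            ((hC' i).2 (j - a) ((Nat.sub_le _ _).trans hj) z hz)
      _ = C * C' * (w₁ i a * w₂ i (j - a)) := by ring
      _ ≤ C * C' * w₃ i j := by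
          refine mul_le_mul_right ?_ _
          simpa [Nat.add_sub_cancel' ha'] using hw i a (j - a) (by omega)
  have hsum : ∑ a ∈ Finset.range (j + 1), (j.choose a : ℝ≥0∞) = 2 ^ j := by
    exact_mod_cast congrArg (Nat.cast : ℕ → ℝ≥0∞) (Nat.sum_range_choose j)
  rw [← Finset.sum_mul, hsum] at key
  push_cast
  rw [enorm_eq_nnnorm, mul_assoc (‖B‖₊ : ℝ≥0∞), mul_assoc ((2 : ℝ≥0∞) ^ N)]
  refine mul_le_mul_right (key.trans ?_) _
  exact mul_le_mul_left (pow_le_pow_right₀ (by norm_num) hj) _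

/-- Separates order zero and shifts the weight by one, so that chain-rule arguments can proceed by
induction on the order. -/
theorem tameBound_succ (hU : ∀ i, IsOpen (U i)) {u : ι → E → V} :
    TameBound U (N + 1) w u ↔ (∃ C : ℝ≥0, ∀ i, ∀ z ∈ U i, ‖u i z‖ₑ ≤ C * w i 0) ∧
      (∀ i, DifferentiableOn ℝ (u i) (U i)) ∧
      TameBound U N (fun i j => w i (j + 1)) (fun i => fderiv ℝ (u i)) := by
  have hs : ∀ i, ContDiffOn ℝ (N + 1 : ℕ) (u i) (U i) ↔
      DifferentiableOn ℝ (u i) (U i) ∧ ContDiffOn ℝ N (fderiv ℝ (u i)) (U i) := by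
    intro i
    have := contDiffOn_succ_iff_fderiv_of_isOpen (𝕜 := ℝ) (n := (N : WithTop ℕ∞)) (f := u i) (hU i)
    rw [show ((N + 1 : ℕ) : WithTop ℕ∞) = (N : WithTop ℕ∞) + 1 by push_cast; rfl, this]
    simp
  constructor
  · rintro ⟨C, hC⟩
    refine ⟨⟨C, fun i z hz => ?_⟩, fun i => ((hs i).1 (hC i).1).1,
      C, fun i => ⟨((hs i).1 (hC i).1).2, fun j hj z hz => ?_⟩⟩
    · rw [← enorm_iteratedFDeriv_zero (u i)]
      exact (hC i).2 0 (Nat.zero_le _) z hz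
    · rw [enorm_iteratedFDeriv_fderiv]
      exact (hC i).2 (j + 1) (by omega) z hz
  · rintro ⟨⟨C, hC⟩, hd, ⟨C', hC'⟩⟩
    refine ⟨max C C', fun i => ⟨(hs i).2 ⟨hd i, (hC' i).1⟩, fun j hj z hz => ?_⟩⟩
    rcases j with _ | j
    · rw [enorm_iteratedFDeriv_zero]
      exact (hC i z hz).trans (by gcongr; exact le_max_left _ _)
    · rw [← enorm_iteratedFDeriv_fderiv]
      exact ((hC' i).2 j (by omega) z hz).trans (by gcongr; exact le_max_right _ _)

theorem tameBound_zero {u : ι → E → V} :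
    TameBound U 0 w u ↔ (∃ C : ℝ≥0, ∀ i, ∀ z ∈ U i, ‖u i z‖ₑ ≤ C * w i 0) ∧
      (∀ i, ContinuousOn (u i) (U i)) := by
  constructor
  · rintro ⟨C, hC⟩
    refine ⟨⟨C, fun i z hz => ?_⟩, fun i => (hC i).1.continuousOn⟩
    rw [← enorm_iteratedFDeriv_zero (u i)]
    exact (hC i).2 0 le_rfl z hz
  · rintro ⟨⟨C, hC⟩, hd⟩
    refine ⟨C, fun i => ⟨by simpa using hd i, fun j hj z hz => ?_⟩⟩
    obtain rfl : j = 0 := by omega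
    rw [enorm_iteratedFDeriv_zero]
    exact hC i z hz

theorem TameBound.bound_zero {u : ι → E → V} (h : TameBound U N w u) :
    ∃ C : ℝ≥0, ∀ i, ∀ z ∈ U i, ‖u i z‖ₑ ≤ C * w i 0 :=
  (tameBound_zero.1 (h.mono_order (Nat.zero_le N))).1

end TameBound

/-! ### Composition and linear fixed-point equations. -/

section TameBound

variable {ι E F V V₁ V₂ V₃ : Type}
  [NormedAddCommGroup E] [NormedSpace ℝ E] [NormedAddCommGroup F] [NormedSpace ℝ F]
  [NormedAddCommGroup V] [NormedSpace ℝ V]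
  [NormedAddCommGroup V₁] [NormedSpace ℝ V₁] [NormedAddCommGroup V₂] [NormedSpace ℝ V₂]
  [NormedAddCommGroup V₃] [NormedSpace ℝ V₃]

/-- The derivative of the composite is `Du ∘ Φ` times `DΦ`: induction handles the first factor with
the shifted weight, the product rule the rest. Only `N - 1` derivatives of `DΦ` enter, which leaves
room for a bootstrap when `Φ` is an inverse map. -/
theorem TameBound.comp {U : ι → Set E} {U' : ι → Set F} (hU : ∀ i, IsOpen (U i))
    (hU' : ∀ i, IsOpen (U' i)) {Φ : ι → F → E} (hΦ : ∀ i, Set.MapsTo (Φ i) (U' i) (U i))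
    (hΦd : ∀ i, DifferentiableOn ℝ (Φ i) (U' i)) {w : ι → ℕ → ℝ≥0∞} (N : ℕ)
    (hw : TameBound U' (N - 1) w (fun i => fderiv ℝ (Φ i))) {v : ι → ℕ → ℝ≥0∞}
    (hv : ∀ i a b, a + 1 + b ≤ N → v i (a + 1) * w i b ≤ v i (a + 1 + b)) {u : ι → E → V}
    (hu : TameBound U N v u) : TameBound U' N v (fun i z => u i (Φ i z)) := by
  induction N generalizing V v with
  | zero =>
    obtain ⟨⟨C, hC⟩, hc⟩ := tameBound_zero.1 hu
    exact tameBound_zero.2 ⟨⟨C, fun i z hz => hC i _ (hΦ i hz)⟩,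
      fun i => (hc i).comp (hΦd i).continuousOn (hΦ i)⟩
  | succ N ih =>
    obtain ⟨⟨C, hC⟩, hd, hD⟩ := (tameBound_succ hU).1 hu
    refine (tameBound_succ hU').2 ⟨⟨C, fun i z hz => hC i _ (hΦ i hz)⟩,
      fun i => (hd i).comp (hΦd i) (hΦ i), ?_⟩
    have h1 := ih (hw.mono_order (by omega)) (v := fun i j => v i (j + 1))
      (fun i a b hab => by
        have := hv i (a + 1) b (by omega)
        rwa [show a + 1 + 1 + b = a + 1 + b + 1 by ring] at this) hD
    have h2 := h1.bilin (w₃ := fun i j => v i (j + 1)) hU' (ContinuousLinearMap.compL ℝ F E V)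
      (fun i a b hab => by
        have := hv i a b (by omega)
        rwa [show a + 1 + b = a + b + 1 by ring] at this) (hw.mono_order (by omega))
    refine h2.congr hU' fun i z hz => ?_
    have := fderiv_comp z ((hd i).differentiableAt ((hU i).mem_nhds (hΦ i hz)))
      ((hΦd i).differentiableAt ((hU' i).mem_nhds hz))
    simpa [Function.comp_def] using this

/-- Absorption into the left side is legitimate because `t` is finite; `A` may be infinite. -/
theorem ENNReal.le_two_mul_of_le_add_half {t A : ℝ≥0∞} (ht : t ≠ ⊤) (h : t ≤ A + 2⁻¹ * t) :
    t ≤ 2 * A := by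
  rcases eq_or_ne A ⊤ with rfl | hA
  · simp
  · lift t to ℝ≥0 using ht
    lift A to ℝ≥0 using hA
    have h' : (t : ℝ≥0∞) ≤ ((A + 2⁻¹ * t : ℝ≥0) : ℝ≥0∞) := by
      simpa using h
    have h2 : t ≤ A + 2⁻¹ * t := ENNReal.coe_le_coe.1 h'
    have h3 : (t : ℝ) ≤ A + 2⁻¹ * t := by exact_mod_cast h2
    have h4 : (t : ℝ) ≤ 2 * A := by linarith
    exact_mod_cast h4

/-- Tame bounds for the solution of the equation `y = c - B(x, y)`. -/
theorem TameBound.of_fixedPoint {U : ι → Set E} (hU : ∀ i, IsOpen (U i)) {N : ℕ}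
    {w : ι → ℕ → ℝ≥0∞} (B : V₁ →L[ℝ] V₂ →L[ℝ] V₂) (hB : ‖B‖ ≤ 1)
    (hw : ∀ i a b, a + b ≤ N → w i a * w i b ≤ w i (a + b))
    {x : ι → E → V₁} {c y : ι → E → V₂} (hx : TameBound U N w x) (hc : TameBound U N w c)
    (hx2 : ∀ i, ∀ z ∈ U i, ‖x i z‖ ≤ 1 / 2) (hy : ∀ i, ContDiffOn ℝ N (y i) (U i))
    (heq : ∀ i, ∀ z ∈ U i, y i z = c i z - B (x i z) (y i z)) :
    TameBound U N w y := by
  obtain ⟨Cx, hCx⟩ := hx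
  obtain ⟨Cc, hCc⟩ := hc
  have hB' : ‖B‖ₑ ≤ 1 := by
    rw [← ofReal_norm]; exact ENNReal.ofReal_le_one.2 hB
  suffices H : ∀ j ≤ N, ∃ C : ℝ≥0, ∀ j' ≤ j, ∀ i, ∀ z ∈ U i,
      ‖iteratedFDeriv ℝ j' (y i) z‖ₑ ≤ C * w i j' by
    obtain ⟨C, hC⟩ := H N le_rfl
    exact ⟨C, fun i => ⟨hy i, fun j hj z hz => hC j hj i z hz⟩⟩
  -- In the Leibniz expansion of B(x, y), the term with all derivatives on y has coefficient at most
  -- 1/2 and is absorbed on the left. The other terms contain y only to orders below j, so the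
  -- bounds follow by induction on j.
  have main : ∀ j ≤ N, ∀ i, ∀ z ∈ U i, ‖iteratedFDeriv ℝ j (y i) z‖ₑ ≤
      2 * (Cc * w i j + ∑ a ∈ Finset.range j, (j.choose (a + 1) : ℝ≥0∞) *
        (Cx * w i (a + 1) * ‖iteratedFDeriv ℝ (j - (a + 1)) (y i) z‖ₑ)) := by
    intro j hj i z hz
    refine ENNReal.le_two_mul_of_le_add_half enorm_ne_top ?_
    have hBxy : ContDiffOn ℝ N (fun z => B (x i z) (y i z)) (U i) :=
      B.isBoundedBilinearMap.contDiff.comp_contDiffOn ((hCx i).1.prodMk (hy i))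
    have e : iteratedFDeriv ℝ j (y i) z = iteratedFDeriv ℝ j (c i) z
        - iteratedFDeriv ℝ j (fun z => B (x i z) (y i z)) z := by
      rw [iteratedFDeriv_congr_of_eqOn (hU i) (heq i) j hz]
      exact fun_iteratedFDeriv_sub_apply
        (((hCc i).1.contDiffAt ((hU i).mem_nhds hz)).of_le (by exact_mod_cast hj))
        ((hBxy.contDiffAt ((hU i).mem_nhds hz)).of_le (by exact_mod_cast hj))
    have hbil := (enorm_iteratedFDeriv_le_of_bilinear B (hU i) (hCx i).1 (hy i) hj hz).trans
      (mul_le_of_le_one_left (zero_le) hB')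
    rw [Finset.sum_range_succ'] at hbil
    have hx0 : ‖x i z‖ₑ ≤ 2⁻¹ := by
      rw [← ofReal_norm]
      refine (ENNReal.ofReal_le_ofReal (hx2 i z hz)).trans (le_of_eq ?_)
      rw [one_div, ENNReal.ofReal_inv_of_pos (by norm_num)]
      simp
    have h0 : ((j.choose 0 : ℕ) : ℝ≥0∞) *
        (‖iteratedFDeriv ℝ 0 (x i) z‖ₑ * ‖iteratedFDeriv ℝ (j - 0) (y i) z‖ₑ)
        ≤ 2⁻¹ * ‖iteratedFDeriv ℝ j (y i) z‖ₑ := by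
      rw [enorm_iteratedFDeriv_zero]
      simp only [Nat.choose_zero_right, Nat.cast_one, one_mul, Nat.sub_zero]
      exact mul_le_mul_left hx0 _
    calc ‖iteratedFDeriv ℝ j (y i) z‖ₑ
        ≤ ‖iteratedFDeriv ℝ j (c i) z‖ₑ
          + ‖iteratedFDeriv ℝ j (fun z => B (x i z) (y i z)) z‖ₑ := by
          rw [e]; exact enorm_sub_le (E := E [×j]→L[ℝ] V₂)
      _ ≤ Cc * w i j + ((∑ a ∈ Finset.range j, (j.choose (a + 1) : ℝ≥0∞) *
        (Cx * w i (a + 1) * ‖iteratedFDeriv ℝ (j - (a + 1)) (y i) z‖ₑ))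
          + 2⁻¹ * ‖iteratedFDeriv ℝ j (y i) z‖ₑ) := by
          refine add_le_add ((hCc i).2 j hj z hz) (hbil.trans (add_le_add ?_ h0))
          refine Finset.sum_le_sum fun a ha => ?_
          have := Finset.mem_range.1 ha
          exact mul_le_mul_right (mul_le_mul_left ((hCx i).2 (a + 1) (by omega) z hz) _) _
      _ = _ := by rw [add_assoc]
  intro j
  induction j with
  | zero =>
    intro hj
    refine ⟨2 * Cc, fun j' hj' i z hz => ?_⟩
    obtain rfl : j' = 0 := by omega
    simpa [mul_assoc] using main 0 hj i z hz
  | succ j ih =>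
    intro hj
    obtain ⟨C, hC⟩ := ih (by omega)
    refine ⟨max C (2 * (Cc + ∑ a ∈ Finset.range (j + 1), ((j + 1).choose (a + 1) : ℝ≥0) *
      (Cx * C))), fun j' hj' i z hz => ?_⟩
    rcases Nat.lt_or_ge j j' with h | h
    · obtain rfl : j' = j + 1 := by omega
      refine (main (j + 1) hj i z hz).trans ?_
      refine le_trans ?_ (mul_le_mul_left (ENNReal.coe_le_coe.2 (le_max_right _ _)) _)
      push_cast
      rw [mul_assoc, add_mul, Finset.sum_mul]
      refine mul_le_mul_right (add_le_add le_rfl (Finset.sum_le_sum fun a ha => ?_)) _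
      have ha' := Finset.mem_range.1 ha
      rw [mul_assoc (((j + 1).choose (a + 1) : ℕ) : ℝ≥0∞)]
      refine mul_le_mul_right ?_ _
      calc _ ≤ Cx * w i (a + 1) * (C * w i (j + 1 - (a + 1))) :=
            mul_le_mul_right (hC _ (by omega) i z hz) _
        _ = Cx * C * (w i (a + 1) * w i (j + 1 - (a + 1))) := by ring
        _ ≤ _ := by
            refine mul_le_mul_right ?_ _
            have := hw i (a + 1) (j + 1 - (a + 1)) (by omega)
            rwa [show a + 1 + (j + 1 - (a + 1)) = j + 1 by omega] at this
    · exact (hC j' h i z hz).trans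
        (mul_le_mul_left (ENNReal.coe_le_coe.2 (le_max_left _ _)) _)

end TameBound

/-! ### Operator-valued functions and the inverse of `1 + x`. -/

section Operators

variable {ι E : Type} [NormedAddCommGroup E] [NormedSpace ℝ E]
  {𝕜 : Type} [NontriviallyNormedField 𝕜] [NormedAlgebra ℝ 𝕜]
  {F G H : Type} [NormedAddCommGroup F] [NormedSpace 𝕜 F] [NormedSpace ℝ F] [IsScalarTower ℝ 𝕜 F]
  [NormedAddCommGroup G] [NormedSpace 𝕜 G] [NormedSpace ℝ G] [IsScalarTower ℝ 𝕜 G]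
  [NormedAddCommGroup H] [NormedSpace 𝕜 H] [NormedSpace ℝ H] [IsScalarTower ℝ 𝕜 H]

/-- Composition of `𝕜`-linear operators as a real bilinear map. -/
def compReal (𝕜 F G H : Type) [NontriviallyNormedField 𝕜] [NormedAlgebra ℝ 𝕜]
    [NormedAddCommGroup F] [NormedSpace 𝕜 F] [NormedSpace ℝ F] [IsScalarTower ℝ 𝕜 F]
    [NormedAddCommGroup G] [NormedSpace 𝕜 G] [NormedSpace ℝ G] [IsScalarTower ℝ 𝕜 G]
    [NormedAddCommGroup H] [NormedSpace 𝕜 H] [NormedSpace ℝ H] [IsScalarTower ℝ 𝕜 H] :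
    (G →L[𝕜] H) →L[ℝ] (F →L[𝕜] G) →L[ℝ] (F →L[𝕜] H) :=
  (ContinuousLinearMap.compL 𝕜 F G H).bilinearRestrictScalars ℝ

theorem norm_compReal_le : ‖compReal 𝕜 F G H‖ ≤ 1 :=
  ContinuousLinearMap.opNorm_le_bound₂ _ zero_le_one fun S T => by
    simpa [compReal] using ContinuousLinearMap.opNorm_comp_le S T

variable {U : ι → Set E} {N : ℕ} {w w₁ w₂ w₃ : ι → ℕ → ℝ≥0∞}

theorem TameBound.clm_comp (hU : ∀ i, IsOpen (U i))
    (hw : ∀ i a b, a + b ≤ N → w₁ i a * w₂ i b ≤ w₃ i (a + b))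
    {S : ι → E → (G →L[𝕜] H)} {T : ι → E → (F →L[𝕜] G)} (hS : TameBound U N w₁ S)
    (hT : TameBound U N w₂ T) : TameBound U N w₃ (fun i z => S i z ∘L T i z) :=
  hS.bilin hU (compReal 𝕜 F G H) hw hT

theorem contDiffAt_ringInverse_real [CompleteSpace F] {x : F →L[𝕜] F} (hx : IsUnit x)
    (N : WithTop ℕ∞) :
    ContDiffAt ℝ N (Ring.inverse : (F →L[𝕜] F) → F →L[𝕜] F) x := by
  obtain ⟨u, rfl⟩ := hx
  exact (contDiffAt_ringInverse 𝕜 u).restrict_scalars ℝ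

theorem isUnit_one_add_of_norm_le [CompleteSpace F] {x : F →L[𝕜] F} (hx : ‖x‖ ≤ 1 / 2) :
    IsUnit (1 + x) := by
  have := (Units.oneSub (-x) (by rw [norm_neg]; linarith)).isUnit
  simpa using this

theorem ringInverse_one_add_eq [CompleteSpace F] {x : F →L[𝕜] F} (hx : ‖x‖ ≤ 1 / 2) :
    Ring.inverse (1 + x) = 1 - x * Ring.inverse (1 + x) := by
  have := Ring.mul_inverse_cancel _ (isUnit_one_add_of_norm_le hx)
  rw [add_mul, one_mul] at this
  exact eq_sub_of_add_eq this

theorem norm_ringInverse_one_add_le [CompleteSpace F] {x : F →L[𝕜] F} (hx : ‖x‖ ≤ 1 / 2) :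
    ‖Ring.inverse (1 + x)‖ ≤ 2 := by
  have h := ringInverse_one_add_eq hx
  have h1 : ‖Ring.inverse (1 + x)‖ ≤ 1 + ‖x‖ * ‖Ring.inverse (1 + x)‖ :=
    calc ‖Ring.inverse (1 + x)‖ = ‖1 - x * Ring.inverse (1 + x)‖ := by rw [← h]
      _ ≤ ‖(1 : F →L[𝕜] F)‖ + ‖x * Ring.inverse (1 + x)‖ := norm_sub_le _ _
      _ ≤ _ := add_le_add ContinuousLinearMap.norm_id_le (norm_mul_le _ _)
  nlinarith [norm_nonneg (Ring.inverse (1 + x))]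

/-- The inverse y of 1 + x satisfies y = 1 - xy, an instance of the fixed-point equation. -/
theorem TameBound.ringInverse [CompleteSpace F] (hU : ∀ i, IsOpen (U i)) (hw0 : ∀ i, 1 ≤ w i 0)
    (hw : ∀ i a b, a + b ≤ N → w i a * w i b ≤ w i (a + b))
    {x : ι → E → (F →L[𝕜] F)} (hx : TameBound U N w x)
    (hx2 : ∀ i, ∀ z ∈ U i, ‖x i z‖ ≤ 1 / 2) :
    TameBound U N w (fun i z => Ring.inverse (1 + x i z)) := by
  refine TameBound.of_fixedPoint hU (compReal 𝕜 F F F) norm_compReal_le hw hx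
    (TameBound.const hw0 1) hx2 (fun i z hz => ?_) fun i z hz => ringInverse_one_add_eq (hx2 i z hz)
  exact (contDiffAt_ringInverse_real (isUnit_one_add_of_norm_le (hx2 i z hz))
    _).comp_contDiffWithinAt z (contDiffWithinAt_const.add (hx.contDiffOn i z hz))

end Operators

/-! ### Complexified differentials in terms of linear and conjugate-linear parts. -/

section ComplexParts

variable {n m : ℕ}

/-- Coordinatewise conjugation as a real linear map. -/
def conjL (n : ℕ) : Cn n →L[ℝ] Cn n :=
  LinearMap.mkContinuous
    { toFun := conjCn
      map_add' := fun v w => by ext i; simp [conjCn]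
      map_smul' := fun c v => by ext i; simp [conjCn] } 1
    (fun v => by simp [conjCn, EuclideanSpace.norm_eq])

@[simp] theorem conjL_apply (v : Cn n) : conjL n v = conjCn v := rfl

@[simp] theorem norm_conjCn (v : Cn n) : ‖conjCn v‖ = ‖v‖ := by
  simp [conjCn, EuclideanSpace.norm_eq]

@[simp] theorem conjCn_conjCn (v : Cn n) : conjCn (conjCn v) = v := by
  ext i; simp [conjCn]

theorem conjCn_smul (c : ℂ) (v : Cn n) : conjCn (c • v) = star c • conjCn v := by
  ext i; simp [conjCn]

theorem conjCn_add (v w : Cn n) : conjCn (v + w) = conjCn v + conjCn w := (conjL n).map_add v w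

theorem norm_conjL_le : ‖conjL n‖ ≤ 1 :=
  ContinuousLinearMap.opNorm_le_bound _ zero_le_one fun v => by simp

theorem map_complex_smul (T : Cn n →L[ℝ] Cn m) (c : ℂ) (a : Cn n) :
    T (c • a) = (c.re : ℂ) • T a + (c.im : ℂ) • T (Complex.I • a) := by
  have h : c • a = c.re • a + c.im • (Complex.I • a) := by
    conv_lhs => rw [← Complex.re_add_im c]
    rw [add_smul, mul_smul, Complex.coe_smul, Complex.coe_smul]
  rw [h, map_add, map_smul, map_smul, Complex.coe_smul, Complex.coe_smul]

theorem I_smul_I_smul (a : Cn n) : Complex.I • Complex.I • a = -a := by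
  rw [smul_smul, Complex.I_mul_I, neg_one_smul]

theorem norm_half_add_I_smul_le {x y : Cn m} {C : ℝ} (hx : ‖x‖ ≤ C) (hy : ‖y‖ ≤ C) :
    ‖(1 / 2 : ℂ) • (x + Complex.I • y)‖ ≤ C := by
  rw [norm_smul]
  have h : ‖x + Complex.I • y‖ ≤ C + C :=
    (norm_add_le _ _).trans (add_le_add hx (by rw [norm_smul]; simpa using hy))
  have h2 : ‖(1 / 2 : ℂ)‖ = 1 / 2 := by simp
  rw [h2]; linarith

/-- The complex linear part of a real linear map: its coefficients along the `∂/∂z_i`. -/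
def holPart (T : Cn n →L[ℝ] Cn m) : Cn n →L[ℂ] Cn m :=
  LinearMap.mkContinuous
    { toFun := fun a => (1 / 2 : ℂ) • (T a + Complex.I • -T (Complex.I • a))
      map_add' := fun a b => by simp only [smul_add, map_add]; module
      map_smul' := fun c a => by
        rw [RingHom.id_apply, map_complex_smul T c a, smul_smul Complex.I c,
          map_complex_smul T (Complex.I * c) a]
        simp only [Complex.mul_re, Complex.mul_im, Complex.I_re, Complex.I_im]
        have hc : c = c.re + c.im * Complex.I := (Complex.re_add_im c).symm
        conv_rhs => rw [hc]
        simp only [smul_add, smul_neg, smul_smul]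
        match_scalars
        · ring_nf
        · ring_nf; simp [Complex.I_sq]; ring } ‖T‖
    (fun a => norm_half_add_I_smul_le (T.le_opNorm a)
      (by rw [norm_neg]; refine (T.le_opNorm _).trans (le_of_eq ?_); rw [norm_smul]; simp))

theorem holPart_apply (T : Cn n →L[ℝ] Cn m) (a : Cn n) :
    holPart T a = (1 / 2 : ℂ) • (T a - Complex.I • T (Complex.I • a)) := by
  rw [sub_eq_add_neg, ← smul_neg]; rfl

/-- The conjugate linear part of a real linear map, composed with the conjugation: its
coefficients along the `∂/∂z̄_i`. -/
def antiPart (T : Cn n →L[ℝ] Cn m) : Cn n →L[ℂ] Cn m :=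
  holPart (T ∘L conjL n)

theorem antiPart_apply (T : Cn n →L[ℝ] Cn m) (b : Cn n) :
    antiPart T b = (1 / 2 : ℂ) • (T (conjCn b) + Complex.I • T (Complex.I • conjCn b)) := by
  have : T (conjCn (Complex.I • b)) = -T (Complex.I • conjCn b) := by
    rw [conjCn_smul, ← map_neg, ← neg_smul]; simp
  rw [antiPart, holPart_apply]
  simp [this]

theorem norm_holPart_le (T : Cn n →L[ℝ] Cn m) : ‖holPart T‖ ≤ ‖T‖ :=
  LinearMap.mkContinuous_norm_le _ (norm_nonneg _) _

theorem norm_antiPart_le (T : Cn n →L[ℝ] Cn m) : ‖antiPart T‖ ≤ ‖T‖ :=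
  (norm_holPart_le _).trans ((ContinuousLinearMap.opNorm_comp_le _ _).trans
    (mul_le_of_le_one_right (norm_nonneg _) norm_conjL_le))

theorem holPart_add (S T : Cn n →L[ℝ] Cn m) : holPart (S + T) = holPart S + holPart T := by
  ext1 a; simp only [holPart_apply, add_apply]; module

theorem antiPart_add (S T : Cn n →L[ℝ] Cn m) : antiPart (S + T) = antiPart S + antiPart T := by
  ext1 a; simp only [antiPart_apply, add_apply]; module

theorem antiPart_sub (S T : Cn n →L[ℝ] Cn m) : antiPart (S - T) = antiPart S - antiPart T := by
  ext1 a; simp only [antiPart_apply, sub_apply]; module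

theorem holPart_smul (c : ℝ) (T : Cn n →L[ℝ] Cn m) : holPart (c • T) = c • holPart T := by
  ext1 a
  simp only [holPart_apply, smul_apply, ← Complex.coe_smul]; module

theorem holPart_id : holPart (1 : Cn n →L[ℝ] Cn n) = 1 := by
  ext1 a
  simp only [holPart_apply, one_apply_eq_self, I_smul_I_smul]; module

theorem antiPart_id : antiPart (1 : Cn n →L[ℝ] Cn n) = 0 := by
  ext1 a
  simp only [antiPart_apply, one_apply_eq_self, I_smul_I_smul]; simp

theorem antiPart_conjL : antiPart (conjL n) = 1 := by
  rw [antiPart, show conjL n ∘L conjL n = 1 by ext1 a; simp, holPart_id]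

theorem holPart_conjL : holPart (conjL n) = 0 := by
  have := antiPart_id (n := n)
  rwa [antiPart, ContinuousLinearMap.one_def, ContinuousLinearMap.id_comp] at this

/-- `holPart` as a real linear map. -/
def holL (n m : ℕ) : (Cn n →L[ℝ] Cn m) →L[ℝ] (Cn n →L[ℂ] Cn m) :=
  LinearMap.mkContinuous
    { toFun := holPart
      map_add' := holPart_add
      map_smul' := holPart_smul } 1 (fun T => by simpa using norm_holPart_le T)

/-- The complexified real linear map applied to `a ∂/∂z + b ∂/∂z̄` in terms of real vectors. -/
theorem holPart_add_antiPart (T : Cn n →L[ℝ] Cn m) (a b : Cn n) :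
    holPart T a + antiPart T b = T ((1 / 2 : ℂ) • (a + conjCn b))
      + Complex.I • T ((1 / 2 : ℂ) • (Complex.I • (conjCn b - a))) := by
  have h2 : ∀ v : Cn n, T ((1 / 2 : ℂ) • v) = (1 / 2 : ℂ) • T v := fun v => by
    rw [map_complex_smul]; simp
  rw [h2, h2, holPart_apply, antiPart_apply, map_add, smul_sub Complex.I, map_sub]
  module

/-- The chain rule for complexified real linear maps. -/
theorem holPart_add_antiPart_comp {l : ℕ} (S : Cn m →L[ℝ] Cn l) (T : Cn n →L[ℝ] Cn m)
    (a b : Cn n) :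
    holPart S (holPart T a + antiPart T b)
      + antiPart S (holPart (conjL m ∘L T) a + antiPart (conjL m ∘L T) b)
      = holPart (S ∘L T) a + antiPart (S ∘L T) b := by
  -- Writing a ∂/∂z + b ∂/∂z̄ as x + √-1 y with real tangent vectors x, y reduces the claim to
  -- composition of real linear maps.
  simp only [holPart_add_antiPart]
  set u := T ((1 / 2 : ℂ) • (a + conjCn b)) with hu
  set v := T ((1 / 2 : ℂ) • (Complex.I • (conjCn b - a))) with hv
  simp only [ContinuousLinearMap.comp_apply, conjL_apply, ← hu, ← hv, conjCn_add, conjCn_smul,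
    conjCn_conjCn]
  congr 2
  · simp; module
  · congr 1
    simp only [Complex.star_def, Complex.conj_I, smul_sub, smul_add, neg_smul, smul_neg,
      I_smul_I_smul]
    module

theorem sum_smul_single (a : Cn n) : ∑ i, a i • (EuclideanSpace.single i (1 : ℂ) : Cn n) = a := by
  ext j; simp [Finset.sum_apply, Pi.single_apply]

theorem cdiff_eq (φ : Cn n → Cn m) (z : Cn n) (X : CTan n) :
    cdiff φ z X = holPart (fderiv ℝ φ z) X.fst + antiPart (fderiv ℝ φ z) X.snd := by
  have hI : ∀ i, (EuclideanSpace.single i Complex.I : Cn n)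
      = Complex.I • EuclideanSpace.single i (1 : ℂ) := fun i => by
    ext j; by_cases h : j = i <;> simp [h]
  have hc : ∀ i, conjCn (EuclideanSpace.single i (1 : ℂ) : Cn n)
      = EuclideanSpace.single i (1 : ℂ) := fun i => by
    ext j; by_cases h : j = i <;> simp [conjCn, h]
  have h1 : ∀ i, wirtinger φ z i = holPart (fderiv ℝ φ z) (EuclideanSpace.single i 1) := fun i => by
    rw [holPart_apply, ← hI]; rfl
  have h2 : ∀ i, wirtingerBar φ z i = antiPart (fderiv ℝ φ z) (EuclideanSpace.single i 1) :=
    fun i => by rw [antiPart_apply, hc, ← hI]; rfl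
  have e : cdiff φ z X = (∑ i, X.fst i • wirtinger φ z i) + ∑ i, X.snd i • wirtingerBar φ z i := rfl
  rw [e]
  conv_rhs => rw [← sum_smul_single X.fst, ← sum_smul_single X.snd]
  simp only [map_sum, map_smul, h1, h2]

/-- A family of real functions as one map to `ℂᵐ`. -/
def vecDef (ρ : Fin m → Cn n → ℝ) (z : Cn n) : Cn m := WithLp.toLp 2 fun l => (ρ l z : ℂ)

theorem vecDef_eq_sum (ρ : Fin m → Cn n → ℝ) (z : Cn n) : vecDef ρ z =
    ∑ l, ContinuousLinearMap.toSpanSingleton ℝ (EuclideanSpace.single l (1 : ℂ) : Cn m) (ρ l z) := by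
  ext j; simp [vecDef, Finset.sum_apply, Pi.single_apply]

theorem differentiableAt_vecDef {ρ : Fin m → Cn n → ℝ} {z : Cn n}
    (hρ : ∀ l, DifferentiableAt ℝ (ρ l) z) : DifferentiableAt ℝ (vecDef ρ) z := by
  rw [funext (vecDef_eq_sum ρ)]
  exact DifferentiableAt.fun_sum fun l _ =>
    (ContinuousLinearMap.differentiableAt _).comp z (hρ l)

/-- Packing the ρ_l into one map to ℂᵐ turns the m tangency conditions into a single operator
equation, the only property of M used in the linear algebra. -/
theorem mem_ctM_iff {ρ : Fin m → Cn n → ℝ} {z : Cn n} (hρ : ∀ l, DifferentiableAt ℝ (ρ l) z)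
    (X : CTan n) : X ∈ ctM ρ z ↔ holPart (fderiv ℝ (vecDef ρ) z) X.fst
      + antiPart (fderiv ℝ (vecDef ρ) z) X.snd = 0 := by
  have hd := differentiableAt_vecDef hρ
  have hf : ∀ l v, fderiv ℝ (fun w => (ρ l w : ℂ)) z v = (fderiv ℝ (vecDef ρ) z v) l := by
    intro l v
    have h := ((EuclideanSpace.proj l : Cn m →L[ℂ] ℂ).restrictScalars ℝ).hasFDerivAt.comp z
      hd.hasFDerivAt
    have h2 : HasFDerivAt (fun w => (ρ l w : ℂ)) _ z := h
    rw [h2.fderiv]; rfl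
  have hc : ∀ l, cdiff (fun w => (ρ l w : ℂ)) z X = (cdiff (vecDef ρ) z X) l := by
    intro l
    simp only [cdiff, LinearMap.coe_mk, AddHom.coe_mk, wirtinger, wirtingerBar, hf]
    simp [mul_add, mul_sub, Finset.sum_add_distrib]
  rw [← cdiff_eq, ctM, Submodule.mem_iInf]
  simp only [LinearMap.mem_ker, hc]
  constructor
  · intro h; ext l; simpa using h l
  · intro h l; rw [h]; rfl

end ComplexParts

/-! ### Right inverse and orthogonal projection onto a kernel. -/

section KernelProjection

variable {n m : ℕ}

/-- The distance of `4 R R†` from the identity. -/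
def gramErr (R : Cn n →L[ℂ] Cn m) : Cn m →L[ℂ] Cn m :=
  (4 : ℂ) • (R ∘L ContinuousLinearMap.adjoint R) - 1

/-- The right inverse `R† (R R†)⁻¹` of `R`. -/
def rightInv (R : Cn n →L[ℂ] Cn m) : Cn m →L[ℂ] Cn n :=
  (4 : ℂ) • (ContinuousLinearMap.adjoint R ∘L Ring.inverse (1 + gramErr R))

/-- The orthogonal projection onto the kernel of `R`. -/
def kerProj (R : Cn n →L[ℂ] Cn m) : Cn n →L[ℂ] Cn n := 1 - rightInv R ∘L R

theorem kerProj_apply (R : Cn n →L[ℂ] Cn m) (b : Cn n) :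
    kerProj R b = b - rightInv R (R b) := by
  simp [kerProj]

theorem add_map_ringInverse {x : Cn n →L[ℂ] Cn n} (hx : ‖x‖ ≤ 1 / 2) (b : Cn n) :
    Ring.inverse (1 + x) b + x (Ring.inverse (1 + x) b) = b := by
  simpa using congrArg (fun A : Cn n →L[ℂ] Cn n => A b)
    (Ring.mul_inverse_cancel _ (isUnit_one_add_of_norm_le hx))

theorem ringInverse_add_map {x : Cn n →L[ℂ] Cn n} (hx : ‖x‖ ≤ 1 / 2) (b : Cn n) :
    Ring.inverse (1 + x) (b + x b) = b := by
  simpa using congrArg (fun A : Cn n →L[ℂ] Cn n => A b)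
    (Ring.inverse_mul_cancel _ (isUnit_one_add_of_norm_le hx))

/-- Because `1 + gramErr R` equals 4RR†, the factor 4 in `rightInv` completes RR† to the operator
being inverted. -/
theorem map_rightInv {R : Cn n →L[ℂ] Cn m} (hR : ‖gramErr R‖ ≤ 1 / 2) (c : Cn m) :
    R (rightInv R c) = c := by
  have h := add_map_ringInverse hR c
  have e : ∀ v, v + gramErr R v = (4 : ℂ) • R (ContinuousLinearMap.adjoint R v) := fun v => by
    simp [gramErr]
  rw [e] at h
  simpa [rightInv] using h

theorem map_kerProj {R : Cn n →L[ℂ] Cn m} (hR : ‖gramErr R‖ ≤ 1 / 2) (b : Cn n) :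
    R (kerProj R b) = 0 := by
  rw [kerProj_apply, map_sub, map_rightInv hR, sub_self]

theorem kerProj_of_mem_ker {R : Cn n →L[ℂ] Cn m} {b : Cn n} (hb : R b = 0) :
    kerProj R b = b := by
  rw [kerProj_apply, hb, map_zero, sub_zero]

/-- The range of `rightInv R` lies in that of R†, which is orthogonal to the kernel of R. -/
theorem inner_rightInv {R : Cn n →L[ℂ] Cn m} {b : Cn n} (hb : R b = 0) (c : Cn m) :
    inner ℂ b (rightInv R c) = 0 := by
  simp [rightInv, ContinuousLinearMap.adjoint_inner_right, hb]

/-- `kerProj R` annihilates the vectors orthogonal to the kernel of `R`. -/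
theorem kerProj_of_orthogonal {R : Cn n →L[ℂ] Cn m} (hR : ‖gramErr R‖ ≤ 1 / 2) {b : Cn n}
    (hb : ∀ a, R a = 0 → inner ℂ a b = 0) : kerProj R b = 0 := by
  have h := map_kerProj hR b
  -- With v = `kerProj R b` in the kernel, both terms of ⟨v, v⟩ = ⟨v, b⟩ - ⟨v, `rightInv R (R b)`⟩
  -- vanish.
  have h1 := hb _ h
  have h2 := inner_rightInv h (R b)
  rw [← inner_self_eq_zero (𝕜 := ℂ)]
  conv_lhs => arg 3; rw [kerProj_apply]
  rw [inner_sub_right, h1, h2, sub_zero]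

end KernelProjection

/-! ### Explicit description of the fibres of T''_μ(M). -/

section AlmostCR

variable {n m : ℕ} {ρ : Fin m → Cn n → ℝ} {z : Cn n} {T : Cn n →L[ℝ] Cn m}

theorem mem_t01M_iff
    (hT : ∀ X, X ∈ ctM ρ z ↔ holPart T X.fst + antiPart T X.snd = 0) (X : CTan n) :
    X ∈ t01M ρ z ↔ X.fst = 0 ∧ antiPart T X.snd = 0 := by
  rw [t01M, Submodule.mem_inf, hT]
  refine and_congr_right fun h => ?_
  rw [show X.fst = 0 from h]; simp

theorem mem_t01M_orthogonal_iff
    (hT : ∀ X, X ∈ ctM ρ z ↔ holPart T X.fst + antiPart T X.snd = 0) (X : CTan n) :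
    X ∈ (t01M ρ z)ᗮ ↔ ∀ b, antiPart T b = 0 → inner ℂ b X.snd = 0 := by
  rw [Submodule.mem_orthogonal]
  constructor
  · intro h b hb
    simpa using h (WithLp.toLp 2 (0, b)) ((mem_t01M_iff hT _).2 ⟨rfl, hb⟩)
  · intro h Z hZ
    obtain ⟨h1, h2⟩ := (mem_t01M_iff hT _).1 hZ
    rw [WithLp.prod_inner_apply]
    have h1' : Z.ofLp.1 = 0 := h1
    rw [h1', inner_zero_left, zero_add]
    exact h _ h2

/-- T' and T'' are orthogonal in the ambient space. Conversely, the T''(M)-component of a tangent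
vector orthogonal to T''(M) is orthogonal to itself. This removes N from the description of τ. -/
theorem t10M_sup_nM (ρ : Fin m → Cn n → ℝ) (z : Cn n) :
    t10M ρ z ⊔ nM ρ z = ctM ρ z ⊓ (t01M ρ z)ᗮ := by
  have horth : t10M ρ z ≤ (t01M ρ z)ᗮ := by
    intro X hX
    rw [Submodule.mem_orthogonal]
    intro Z hZ
    have h1 : Z.ofLp.1 = 0 := hZ.1
    have h2 : X.ofLp.2 = 0 := hX.1
    rw [WithLp.prod_inner_apply, h1, h2]
    simp
  apply le_antisymm
  · refine sup_le (le_inf inf_le_right horth) (le_inf inf_le_left ?_)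
    exact inf_le_right.trans (Submodule.orthogonal_le le_sup_right)
  · rintro Y ⟨hY1, hY2⟩
    have hle : t10M ρ z ⊔ t01M ρ z ≤ ctM ρ z := sup_le inf_le_right inf_le_right
    have hsup := Submodule.sup_orthogonal_inf_of_hasOrthogonalProjection hle
    obtain ⟨S, hS, N, hN, rfl⟩ := Submodule.mem_sup.1 (hsup.ge hY1)
    obtain ⟨A, hA, B, hB, rfl⟩ := Submodule.mem_sup.1 hS
    have hN' : N ∈ nM ρ z := ⟨hN.2, hN.1⟩
    have hBo : B ∈ (t01M ρ z)ᗮ := by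
      have hNo : N ∈ (t01M ρ z)ᗮ := Submodule.orthogonal_le le_sup_right hN.1
      have := Submodule.sub_mem _ (Submodule.sub_mem _ hY2 hNo) (horth hA)
      simpa using this
    have hB0 : B = 0 := by
      have := (Submodule.mem_orthogonal _ _).1 hBo B hB
      exact inner_self_eq_zero.1 this
    rw [hB0, add_zero]
    exact Submodule.add_mem_sup hA hN'

/-- Orthogonality to T''(M) puts the ∂/∂z̄-part of τ(μ(Z)) in the range of the right inverse, and
tangency then determines it from the ∂/∂z-part μ(Z). -/
theorem mem_almostCR_iff
    (hT : ∀ X, X ∈ ctM ρ z ↔ holPart T X.fst + antiPart T X.snd = 0)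
    (hR : ‖gramErr (antiPart T)‖ ≤ 1 / 2) (μ : Form01 n) (X : CTan n) :
    X ∈ almostCR ρ μ z ↔ ∃ b, antiPart T b = 0 ∧ X.fst = -(μ z b) ∧
      X.snd = b + rightInv (antiPart T) (holPart T (μ z b)) := by
  constructor
  · rintro ⟨Z, hZ, Y, hY, hYf, rfl⟩
    rw [t10M_sup_nM] at hY
    obtain ⟨hZ1, hZ2⟩ := (mem_t01M_iff hT _).1 hZ
    have hY1 := (hT _).1 hY.1
    have hY2 := kerProj_of_orthogonal hR ((mem_t01M_orthogonal_iff hT _).1 hY.2)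
    refine ⟨Z.snd, hZ2, ?_, ?_⟩
    · rw [WithLp.sub_fst, hZ1, hYf, zero_sub]
    · rw [WithLp.sub_snd, sub_eq_add_neg]
      congr 1
      rw [kerProj_apply, sub_eq_zero] at hY2
      rw [← hYf, eq_neg_of_add_eq_zero_left hY1, map_neg, ← hY2]
  · rintro ⟨b, hb, h1, h2⟩
    refine ⟨WithLp.toLp 2 (0, b), (mem_t01M_iff hT _).2 ⟨rfl, hb⟩,
      WithLp.toLp 2 (μ z b, -rightInv (antiPart T) (holPart T (μ z b))), ?_, rfl, ?_⟩
    · rw [t10M_sup_nM]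
      refine ⟨(hT _).2 ?_, (mem_t01M_orthogonal_iff hT _).2 fun a ha => ?_⟩
      · simp [map_rightInv hR]
      · simp [inner_rightInv ha]
    · apply WithLp.ofLp_injective
      refine Prod.ext ?_ ?_
      · simpa using h1
      · simpa using h2

end AlmostCR

/-! ### The image of a fibre under DF. -/

section PushForward

variable {n m : ℕ}

/-- The differential of the defining functions of the image, transported to the source. -/
def pushDiff (T : Cn n →L[ℝ] Cn m) (D : Cn n →L[ℝ] Cn n) : Cn n →L[ℝ] Cn m :=
  T ∘L Ring.inverse (1 + D)

/-- `b ↦ J(R'(μ b))`, the part of `τ(μ b)` along the `∂/∂z̄_i`, up to sign. -/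
def tauBar (T : Cn n →L[ℝ] Cn m) (μ : Cn n →L[ℂ] Cn n) : Cn n →L[ℂ] Cn n :=
  (rightInv (antiPart T) ∘L holPart T) ∘L μ

/-- The `∂/∂z̄_i`-part of `DF(Z - τ(μ(Z)))` is `Z` plus this operator applied to `Z`. -/
def barPert (T : Cn n →L[ℝ] Cn m) (D : Cn n →L[ℝ] Cn n) (μ : Cn n →L[ℂ] Cn n) :
    Cn n →L[ℂ] Cn n :=
  tauBar T μ + antiPart (conjL n ∘L D) ∘L (1 + tauBar T μ) - holPart (conjL n ∘L D) ∘L μ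

/-- `1 + frameErr T D μ` maps `T''(M)` isomorphically to `T''(M*)`. -/
def frameErr (T : Cn n →L[ℝ] Cn m) (D : Cn n →L[ℝ] Cn n) (μ : Cn n →L[ℂ] Cn n) :
    Cn n →L[ℂ] Cn n :=
  kerProj (antiPart (pushDiff T D)) ∘L barPert T D μ
    + rightInv (antiPart (pushDiff T D)) ∘L (antiPart T - antiPart (pushDiff T D))

/-- The `∂/∂z_i`-part of `DF(Z - τ(μ(Z)))`, where `q = ∂̄f - μ` on `T''(M)`. -/
def holImage (T : Cn n →L[ℝ] Cn m) (D : Cn n →L[ℝ] Cn n) (μ q : Cn n →L[ℂ] Cn n) :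
    Cn n →L[ℂ] Cn n :=
  q + (antiPart D ∘L (rightInv (antiPart T) ∘L holPart T) - holPart D) ∘L μ

/-- The normalized coefficient matrix of the image structure. -/
def imageForm (T : Cn n →L[ℝ] Cn m) (D : Cn n →L[ℝ] Cn n) (μ q : Cn n →L[ℂ] Cn n) :
    Cn n →L[ℂ] Cn n :=
  -(holImage T D μ q ∘L (Ring.inverse (1 + frameErr T D μ) ∘L
    kerProj (antiPart (pushDiff T D))))

/-- The smallness conditions under which the operators above are invertible. -/
structure SmallData (T : Cn n →L[ℝ] Cn m) (D : Cn n →L[ℝ] Cn n) (μ : Cn n →L[ℂ] Cn n) : Prop where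
  diff : ‖D‖ ≤ 1 / 2
  gram : ‖gramErr (antiPart T)‖ ≤ 1 / 2
  gram_push : ‖gramErr (antiPart (pushDiff T D))‖ ≤ 1 / 2
  frame : ‖frameErr T D μ‖ ≤ 1 / 2

variable {T : Cn n →L[ℝ] Cn m} {D : Cn n →L[ℝ] Cn n} {μ q : Cn n →L[ℂ] Cn n}

theorem SmallData.pushDiff_comp (h : SmallData T D μ) : pushDiff T D ∘L (1 + D) = T := by
  have := Ring.inverse_mul_cancel _ (isUnit_one_add_of_norm_le h.diff)
  ext1 v
  have h2 := congrArg (fun A => T (A v)) this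
  simpa [pushDiff] using h2

/-- When Rb = 0, the second summand of `frameErr` turns b into its projection; thus `1 + frameErr`
records the T''(M*)-component of the ∂/∂z̄-part of the image vector. -/
theorem SmallData.frame_apply (T : Cn n →L[ℝ] Cn m) (D : Cn n →L[ℝ] Cn n)
    (μ : Cn n →L[ℂ] Cn n) {b : Cn n} (hb : antiPart T b = 0) :
    b + frameErr T D μ b = kerProj (antiPart (pushDiff T D)) (b + barPert T D μ b) := by
  simp [frameErr, hb, map_add]
  rw [kerProj_apply _ b]
  abel

/-- The projected term is killed and the right inverse cancels, leaving R*b + (Rb - R*b). That this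
holds for every b, not only on the kernel of R, lets the inverse on ℂⁿ carry the kernel of R* back
into that of R. -/
theorem SmallData.map_frame (h : SmallData T D μ) (b : Cn n) :
    antiPart (pushDiff T D) (b + frameErr T D μ b) = antiPart T b := by
  simp [frameErr, map_kerProj h.gram_push, map_rightInv h.gram_push]

theorem SmallData.exists_preimage (h : SmallData T D μ) {β : Cn n}
    (hβ : antiPart (pushDiff T D) β = 0) :
    antiPart T (Ring.inverse (1 + frameErr T D μ) β) = 0 ∧
      Ring.inverse (1 + frameErr T D μ) β
        + frameErr T D μ (Ring.inverse (1 + frameErr T D μ) β) = β := by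
  have h2 := add_map_ringInverse h.frame β
  refine ⟨?_, h2⟩
  rw [← h.map_frame, h2, hβ]

variable {ρ ρs : Fin m → Cn n → ℝ} {z : Cn n} {F : Cn n → Cn n}

theorem pushCT_fst (hF : fderiv ℝ F z = 1 + D) (X : CTan n) :
    (pushCT F z X).fst = X.fst + (holPart D X.fst + antiPart D X.snd) := by
  have : (pushCT F z X).fst = cdiff F z X := rfl
  rw [this, cdiff_eq, hF, holPart_add, antiPart_add, holPart_id, antiPart_id]
  simp [add_assoc]

theorem fderiv_conjCn_comp (hFd : DifferentiableAt ℝ F z) :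
    fderiv ℝ (fun w => conjCn (F w)) z = conjL n ∘L fderiv ℝ F z :=
  ((conjL n).hasFDerivAt.comp z hFd.hasFDerivAt).fderiv

theorem pushCT_snd (hFd : DifferentiableAt ℝ F z) (hF : fderiv ℝ F z = 1 + D) (X : CTan n) :
    (pushCT F z X).snd =
      X.snd + (holPart (conjL n ∘L D) X.fst + antiPart (conjL n ∘L D) X.snd) := by
  have : (pushCT F z X).snd = cdiff (fun w => conjCn (F w)) z X := rfl
  have e : conjL n ∘L (1 + D) = conjL n + conjL n ∘L D := by ext1; simp
  rw [this, cdiff_eq, fderiv_conjCn_comp hFd, hF, e, holPart_add, antiPart_add, holPart_conjL,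
    antiPart_conjL]
  simp only [add_apply, zero_apply, one_apply_eq_self]
  abel

/-- The chain rule for the complexified differential. -/
theorem pushCT_tangent (h : SmallData T D μ) (hFd : DifferentiableAt ℝ F z)
    (hF : fderiv ℝ F z = 1 + D) (X : CTan n) :
    holPart (pushDiff T D) (pushCT F z X).fst + antiPart (pushDiff T D) (pushCT F z X).snd
      = holPart T X.fst + antiPart T X.snd := by
  have h1 : (pushCT F z X).fst = holPart (1 + D) X.fst + antiPart (1 + D) X.snd := by
    rw [← hF]; exact cdiff_eq F z X
  have h2 : (pushCT F z X).snd
      = holPart (conjL n ∘L (1 + D)) X.fst + antiPart (conjL n ∘L (1 + D)) X.snd := by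
    rw [← hF, ← fderiv_conjCn_comp hFd]; exact cdiff_eq _ z X
  rw [h1, h2, holPart_add_antiPart_comp, h.pushDiff_comp]

variable {μf μs : Form01 n}

/-- The image under `DF` of the fibre of `T''_μ(M)` at `z` is the fibre of `T''_{μ*}(M*)` at
`F z` if and only if `μ*` has prescribed values on the image of `T''(M)`. -/
theorem image_almostCR_iff (h : SmallData T D (μf z)) (hFd : DifferentiableAt ℝ F z)
    (hF : fderiv ℝ F z = 1 + D)
    (hT : ∀ X, X ∈ ctM ρ z ↔ holPart T X.fst + antiPart T X.snd = 0)
    (hTs : ∀ X, X ∈ ctM ρs (F z) ↔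
      holPart (pushDiff T D) X.fst + antiPart (pushDiff T D) X.snd = 0)
    (hq : ∀ b, antiPart T b = 0 → q b = antiPart D b - μf z b) :
    pushCT F z '' almostCR ρ μf z = almostCR ρs μs (F z) ↔
      ∀ b, antiPart T b = 0 →
        μs (F z) (b + frameErr T D (μf z) b) = -holImage T D (μf z) q b := by
  set Xb : Cn n → CTan n := fun b => WithLp.toLp 2 (-(μf z b), b + tauBar T (μf z) b) with hXb
  have hfst : ∀ b, antiPart T b = 0 →
      (pushCT F z (Xb b)).fst = holImage T D (μf z) q b := by
    intro b hb
    rw [pushCT_fst hF]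
    simp only [hXb, WithLp.toLp_fst, WithLp.toLp_snd, holImage, add_apply, sub_apply,
      ContinuousLinearMap.comp_apply, map_neg, map_add, tauBar, hq b hb]
    abel
  have hsnd : ∀ b, (pushCT F z (Xb b)).snd = b + barPert T D (μf z) b := by
    intro b
    rw [pushCT_snd hFd hF]
    simp only [hXb, WithLp.toLp_fst, WithLp.toLp_snd, barPert, add_apply, sub_apply,
      ContinuousLinearMap.comp_apply, map_neg, map_add, one_apply_eq_self]
    abel
  have htan : ∀ b, antiPart T b = 0 →
      holPart (pushDiff T D) (pushCT F z (Xb b)).fst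
        + antiPart (pushDiff T D) (pushCT F z (Xb b)).snd = 0 := by
    intro b hb
    rw [pushCT_tangent h hFd hF]
    simp [hXb, tauBar, map_rightInv h.gram, hb]
  have hmem : ∀ b, antiPart T b = 0 → Xb b ∈ almostCR ρ μf z := fun b hb =>
    (mem_almostCR_iff hT h.gram μf _).2 ⟨b, hb, rfl, rfl⟩
  have hker : ∀ b, antiPart T b = 0 →
      antiPart (pushDiff T D) (b + frameErr T D (μf z) b) = 0 := fun b hb => by
    rw [h.map_frame, hb]
  -- The image is tangent to M*, so the part of its ∂/∂z̄-component orthogonal to T''(M*) is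
  -- determined by its ∂/∂z-component.
  have hsnd' : ∀ b, antiPart T b = 0 → (pushCT F z (Xb b)).snd =
      (b + frameErr T D (μf z) b) - rightInv (antiPart (pushDiff T D))
        (holPart (pushDiff T D) (holImage T D (μf z) q b)) := by
    intro b hb
    rw [SmallData.frame_apply T D (μf z) hb, ← hsnd, kerProj_apply, ← hfst b hb,
      eq_neg_of_add_eq_zero_left (htan b hb), map_neg]
    abel
  constructor
  · intro heq b hb
    have hb1 : pushCT F z (Xb b) ∈ almostCR ρs μs (F z) := heq ▸ Set.mem_image_of_mem _ (hmem b hb)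
    obtain ⟨β, hβ, h1, h2⟩ := (mem_almostCR_iff hTs h.gram_push μs _).1 hb1
    have : b + frameErr T D (μf z) b = β := by
      rw [SmallData.frame_apply T D (μf z) hb, ← hsnd, h2, map_add, kerProj_of_mem_ker hβ,
        kerProj_apply, map_rightInv h.gram_push, sub_self, add_zero]
    rw [this, ← hfst b hb, h1, neg_neg]
  · intro hμs
    have hpush : ∀ b, antiPart T b = 0 → (pushCT F z (Xb b)).fst =
          -(μs (F z) (b + frameErr T D (μf z) b)) ∧
        (pushCT F z (Xb b)).snd = (b + frameErr T D (μf z) b)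
          + rightInv (antiPart (pushDiff T D)) (holPart (pushDiff T D)
            (μs (F z) (b + frameErr T D (μf z) b))) := by
      intro b hb
      refine ⟨by rw [hfst b hb, hμs b hb, neg_neg], ?_⟩
      rw [hsnd' b hb, hμs b hb, map_neg, map_neg, sub_eq_add_neg]
    apply Set.Subset.antisymm
    · rintro _ ⟨X, hX, rfl⟩
      obtain ⟨b, hb, h1, h2⟩ := (mem_almostCR_iff hT h.gram μf _).1 hX
      obtain rfl : X = Xb b := WithLp.ofLp_injective 2 (Prod.ext h1 h2)
      exact (mem_almostCR_iff hTs h.gram_push μs _).2 ⟨_, hker b hb, hpush b hb⟩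
    -- Every β in T''(M*) has the form (1 + E)b with b in T''(M), so the whole target fibre is
    -- reached.
    · intro Y hY
      obtain ⟨β, hβ, h1, h2⟩ := (mem_almostCR_iff hTs h.gram_push μs _).1 hY
      obtain ⟨hb, hbβ⟩ := h.exists_preimage hβ
      refine ⟨_, hmem _ hb, ?_⟩
      obtain ⟨e1, e2⟩ := hpush _ hb
      rw [hbβ] at e1 e2
      exact WithLp.ofLp_injective 2 (Prod.ext (e1.trans h1.symm) (e2.trans h2.symm))

theorem SmallData.imageForm_frame (h : SmallData T D μ) {b : Cn n} (hb : antiPart T b = 0) :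
    imageForm T D μ q (b + frameErr T D μ b) = -holImage T D μ q b := by
  have hk : kerProj (antiPart (pushDiff T D)) (b + frameErr T D μ b) = b + frameErr T D μ b :=
    kerProj_of_mem_ker (by rw [h.map_frame, hb])
  simp only [imageForm, neg_apply, ContinuousLinearMap.comp_apply, hk,
    ringInverse_add_map h.frame]

end PushForward

/-! ### Smallness thresholds near the flat model. -/

section Smallness

variable {n m d : ℕ}

/-- The vector of the imaginary parts of the last `m` coordinates. -/
def imPart (d m : ℕ) : Cn (d + m) →L[ℝ] Cn m :=
  LinearMap.toContinuousLinearMap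
    { toFun := fun v => WithLp.toLp 2 fun l => ((v (Fin.natAdd d l)).im : ℂ)
      map_add' := fun v w => by ext l; simp
      map_smul' := fun c v => by ext l; simp }

theorem imPart_apply (v : Cn (d + m)) (l : Fin m) :
    imPart d m v l = ((v (Fin.natAdd d l)).im : ℂ) := rfl

theorem norm_imPart_le : ‖imPart d m‖ ≤ 1 := by
  refine ContinuousLinearMap.opNorm_le_bound _ zero_le_one fun v => ?_
  rw [one_mul, EuclideanSpace.norm_eq, EuclideanSpace.norm_eq]
  refine Real.sqrt_le_sqrt ?_
  rw [Fin.sum_univ_add]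
  refine (Finset.sum_le_sum fun l _ => ?_).trans
    (le_add_of_nonneg_left (Finset.sum_nonneg fun _ _ => by positivity))
  rw [imPart_apply]
  gcongr
  simpa using Complex.abs_im_le_norm (v (Fin.natAdd d l))

theorem antiPart_imPart_apply (b : Cn (d + m)) (l : Fin m) :
    antiPart (imPart d m) b l = Complex.I / 2 * b (Fin.natAdd d l) := by
  rw [antiPart_apply]
  simp only [PiLp.smul_apply, PiLp.add_apply, imPart_apply, conjCn, smul_eq_mul]
  apply Complex.ext <;> simp

/-- In the flat model R is √-1/2 times a coordinate projection, so RR† = 1/4; this is the origin of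
the factor 4 in `gramErr`. -/
theorem gramErr_antiPart_imPart : gramErr (antiPart (imPart d m)) = 0 := by
  set A : Cn m →L[ℂ] Cn (d + m) := LinearMap.toContinuousLinearMap
    { toFun := fun c => WithLp.toLp 2
        (Fin.addCases (fun _ => 0) fun l => -(Complex.I / 2) * c l : Fin (d + m) → ℂ)
      map_add' := fun v w => by
        ext l; refine Fin.addCases (fun i => ?_) (fun i => ?_) l <;> simp [mul_add]
        try ring
      map_smul' := fun c v => by
        ext l; refine Fin.addCases (fun i => ?_) (fun i => ?_) l <;> simp
        try ring } with hA
  have hAl : ∀ c i, A c (Fin.castAdd m i) = 0 := fun c i => by simp [hA]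
  have hAr : ∀ c i, A c (Fin.natAdd d i) = -(Complex.I / 2) * c i := fun c i => by simp [hA]
  have hadj : ContinuousLinearMap.adjoint (antiPart (imPart d m)) = A := by
    symm
    rw [ContinuousLinearMap.eq_adjoint_iff]
    intro x y
    simp only [PiLp.inner_apply, Fin.sum_univ_add, hAl, hAr, antiPart_imPart_apply]
    simp only [inner_zero_left, Finset.sum_const_zero, zero_add]
    refine Finset.sum_congr rfl fun i _ => ?_
    simp only [RCLike.inner_apply, map_mul, map_neg, map_div₀, Complex.conj_I, map_ofNat]
    ring
  rw [gramErr, hadj, sub_eq_zero]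
  ext c l
  simp only [smul_apply, ContinuousLinearMap.comp_apply, PiLp.smul_apply, antiPart_imPart_apply,
    hAr, one_apply_eq_self, smul_eq_mul]
  linear_combination (-c l) * Complex.I_sq

theorem norm_gramErr_sub_le (R R₀ : Cn n →L[ℂ] Cn m) :
    ‖gramErr R - gramErr R₀‖ ≤ 4 * (‖R - R₀‖ * (‖R‖ + ‖R₀‖)) := by
  have e : gramErr R - gramErr R₀ = (4 : ℂ) • ((R - R₀) ∘L ContinuousLinearMap.adjoint R
      + R₀ ∘L ContinuousLinearMap.adjoint (R - R₀)) := by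
    ext1 c
    simp [gramErr]
    module
  rw [e, norm_smul]
  have h1 : ‖(R - R₀) ∘L ContinuousLinearMap.adjoint R‖ ≤ ‖R - R₀‖ * ‖R‖ := by
    simpa using ContinuousLinearMap.opNorm_comp_le (R - R₀) (ContinuousLinearMap.adjoint R)
  have h2 : ‖R₀ ∘L ContinuousLinearMap.adjoint (R - R₀)‖ ≤ ‖R₀‖ * ‖R - R₀‖ := by
    have := ContinuousLinearMap.opNorm_comp_le R₀ (ContinuousLinearMap.adjoint (R - R₀))
    rwa [LinearIsometryEquiv.norm_map] at this
  have h3 : ‖(4 : ℂ)‖ = 4 := by simp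
  rw [h3]
  nlinarith [norm_add_le ((R - R₀) ∘L ContinuousLinearMap.adjoint R)
    (R₀ ∘L ContinuousLinearMap.adjoint (R - R₀))]

theorem norm_rightInv_le {R : Cn n →L[ℂ] Cn m} (hR : ‖gramErr R‖ ≤ 1 / 2) :
    ‖rightInv R‖ ≤ 8 * ‖R‖ := by
  have h1 : ‖ContinuousLinearMap.adjoint R ∘L Ring.inverse (1 + gramErr R)‖ ≤ ‖R‖ * 2 := by
    refine (ContinuousLinearMap.opNorm_comp_le _ _).trans ?_
    rw [LinearIsometryEquiv.norm_map]
    exact mul_le_mul_of_nonneg_left (norm_ringInverse_one_add_le hR) (norm_nonneg _)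
  have h3 : ‖(4 : ℂ)‖ = 4 := by simp
  rw [rightInv, norm_smul, h3]
  linarith

theorem norm_comp_le_of_le {n₁ n₂ n₃ : ℕ} {S : Cn n₂ →L[ℂ] Cn n₃} {T : Cn n₁ →L[ℂ] Cn n₂} {a b : ℝ}
    (hS : ‖S‖ ≤ a) (hT : ‖T‖ ≤ b) : ‖S ∘L T‖ ≤ a * b :=
  (ContinuousLinearMap.opNorm_comp_le S T).trans
    (mul_le_mul hS hT (norm_nonneg _) ((norm_nonneg _).trans hS))

theorem norm_kerProj_le {R : Cn n →L[ℂ] Cn m} (hR : ‖gramErr R‖ ≤ 1 / 2) :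
    ‖kerProj R‖ ≤ 1 + 8 * ‖R‖ * ‖R‖ :=
  (norm_sub_le _ _).trans (add_le_add ContinuousLinearMap.norm_id_le
    (norm_comp_le_of_le (norm_rightInv_le hR) le_rfl))

theorem norm_conjL_comp_le (D : Cn n →L[ℝ] Cn n) : ‖conjL n ∘L D‖ ≤ ‖D‖ :=
  (ContinuousLinearMap.opNorm_comp_le _ _).trans (mul_le_of_le_one_left (norm_nonneg _) norm_conjL_le)

/-- At T = `imPart`, D = 0, μ = 0 all the error operators vanish. The numerical thresholds are
convenient choices keeping each perturbation below 1/2. -/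
theorem smallData_of_norm_le {T : Cn (d + m) →L[ℝ] Cn m} {D : Cn (d + m) →L[ℝ] Cn (d + m)}
    {μ : Cn (d + m) →L[ℂ] Cn (d + m)} (hT : ‖T - imPart d m‖ ≤ 1 / 40) (hD : ‖D‖ ≤ 1 / 1000)
    (hμ : ‖μ‖ ≤ 1 / 1000) : SmallData T D μ := by
  have hD2 : ‖D‖ ≤ 1 / 2 := hD.trans (by norm_num)
  have hTn : ‖T‖ ≤ 41 / 40 := by
    have := norm_le_insert' T (imPart d m)
    linarith [norm_imPart_le (d := d) (m := m)]
  have hpush : ‖T - pushDiff T D‖ ≤ 41 / 40 * (1 / 1000 * 2) := by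
    have e : T - pushDiff T D = T ∘L (D * Ring.inverse (1 + D)) := by
      rw [pushDiff]
      conv_lhs => rw [ringInverse_one_add_eq hD2]
      ext1 v; simp
    rw [e]
    refine (ContinuousLinearMap.opNorm_comp_le _ _).trans
      (mul_le_mul hTn ?_ (norm_nonneg _) (by norm_num))
    exact (norm_mul_le _ _).trans (mul_le_mul hD (norm_ringInverse_one_add_le hD2)
      (norm_nonneg _) (by norm_num))
  have hR0 : ‖antiPart (imPart d m)‖ ≤ 1 := (norm_antiPart_le _).trans norm_imPart_le
  have hR : ‖antiPart T - antiPart (imPart d m)‖ ≤ 1 / 40 := by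
    rw [← antiPart_sub]; exact (norm_antiPart_le _).trans hT
  have hRs : ‖antiPart T - antiPart (pushDiff T D)‖ ≤ 41 / 40 * (1 / 1000 * 2) := by
    rw [← antiPart_sub]; exact (norm_antiPart_le _).trans hpush
  have hRn : ‖antiPart T‖ ≤ 41 / 40 := (norm_antiPart_le _).trans hTn
  have hRs0 : ‖antiPart (pushDiff T D) - antiPart (imPart d m)‖ ≤ 1 / 20 := by
    have := norm_sub_le_norm_sub_add_norm_sub (antiPart (pushDiff T D)) (antiPart T)
      (antiPart (imPart d m))
    rw [norm_sub_rev (antiPart (pushDiff T D)) (antiPart T)] at this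
    linarith
  have hRsn : ‖antiPart (pushDiff T D)‖ ≤ 21 / 20 := by
    have := norm_le_insert' (antiPart (pushDiff T D)) (antiPart (imPart d m))
    linarith
  have hgram : ∀ R : Cn (d + m) →L[ℂ] Cn m, ‖R - antiPart (imPart d m)‖ ≤ 1 / 20 →
      ‖R‖ ≤ 21 / 20 → ‖gramErr R‖ ≤ 1 / 2 := by
    intro R h1 h2
    have := norm_gramErr_sub_le R (antiPart (imPart d m))
    rw [gramErr_antiPart_imPart, sub_zero] at this
    refine this.trans ?_
    have h3 : ‖R - antiPart (imPart d m)‖ * (‖R‖ + ‖antiPart (imPart d m)‖)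
        ≤ 1 / 20 * (21 / 20 + 1) := by gcongr
    linarith
  have hg := hgram _ (hR.trans (by norm_num)) (hRn.trans (by norm_num))
  have hgs := hgram _ hRs0 hRsn
  have hJ : ‖rightInv (antiPart T)‖ ≤ 9 := (norm_rightInv_le hg).trans (by linarith)
  have hJs : ‖rightInv (antiPart (pushDiff T D))‖ ≤ 9 := (norm_rightInv_le hgs).trans (by linarith)
  have hK : ‖kerProj (antiPart (pushDiff T D))‖ ≤ 11 := by
    refine (norm_kerProj_le hgs).trans ?_
    nlinarith [norm_nonneg (antiPart (pushDiff T D))]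
  have htau : ‖tauBar T μ‖ ≤ 9 * (41 / 40) * (1 / 1000) :=
    norm_comp_le_of_le (norm_comp_le_of_le hJ ((norm_holPart_le _).trans hTn)) hμ
  have hcD := (norm_conjL_comp_le D).trans hD
  have h1tau : ‖(1 : Cn (d + m) →L[ℂ] Cn (d + m)) + tauBar T μ‖ ≤ 2 := by
    refine (norm_add_le _ _).trans ?_
    have : ‖(1 : Cn (d + m) →L[ℂ] Cn (d + m))‖ ≤ 1 := ContinuousLinearMap.norm_id_le
    linarith
  have hpert : ‖barPert T D μ‖ ≤ 20 / 1000 := by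
    have h1 := norm_comp_le_of_le ((norm_antiPart_le _).trans hcD) h1tau
    have h2 := norm_comp_le_of_le ((norm_holPart_le _).trans hcD) hμ
    refine (norm_sub_le _ _).trans ?_
    have h3 := norm_add_le (tauBar T μ) (antiPart (conjL (d + m) ∘L D) ∘L (1 + tauBar T μ))
    linarith
  refine ⟨hD2, hg, hgs, ?_⟩
  refine (norm_add_le _ _).trans ?_
  have h1 := norm_comp_le_of_le hK hpert
  have h2 := norm_comp_le_of_le hJs hRs
  linarith

end Smallness

/-! ### Inverting the map z + f(z). -/

section Diffeo

variable {n : ℕ} {B : Set (Cn n)} {f F : Cn n → Cn n}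

/-- The mean value inequality on the convex set makes f 1/2-Lipschitz; injectivity, openness of the
image and the local inverse all follow from this. -/
theorem approximatesLinearOn_id_add (hB : IsOpen B) (hconv : Convex ℝ B)
    (hf : DifferentiableOn ℝ f B) (hD : ∀ z ∈ B, ‖fderiv ℝ f z‖ ≤ 1 / 2)
    (hF : F = fun z => z + f z) :
    ApproximatesLinearOn F ((ContinuousLinearEquiv.refl ℝ (Cn n) : Cn n ≃L[ℝ] Cn n) :
      Cn n →L[ℝ] Cn n) B (1 / 2) := by
  intro x hx y hy
  have := hconv.norm_image_sub_le_of_norm_fderiv_le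
    (fun z hz => hf.differentiableAt (hB.mem_nhds hz)) hD hy hx
  subst hF
  simpa [add_sub_add_comm] using this

/-- The first alternative covers n = 0, where the identity has norm 0. -/
theorem half_lt_inv_nnnorm_refl : Subsingleton (Cn n) ∨ (1 / 2 : ℝ≥0) <
    ‖((ContinuousLinearEquiv.refl ℝ (Cn n)).symm : Cn n →L[ℝ] Cn n)‖₊⁻¹ := by
  rcases subsingleton_or_nontrivial (Cn n) with h | h
  · exact Or.inl h
  · right
    have : ‖((ContinuousLinearEquiv.refl ℝ (Cn n)).symm : Cn n →L[ℝ] Cn n)‖₊ = 1 :=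
      NNReal.eq ContinuousLinearMap.norm_id
    rw [this, inv_one]
    exact NNReal.half_lt_self one_ne_zero

theorem injOn_id_add (hB : IsOpen B) (hconv : Convex ℝ B)
    (hf : DifferentiableOn ℝ f B) (hD : ∀ z ∈ B, ‖fderiv ℝ f z‖ ≤ 1 / 2)
    (hF : F = fun z => z + f z) : Set.InjOn F B :=
  (approximatesLinearOn_id_add hB hconv hf hD hF).injOn half_lt_inv_nnnorm_refl

theorem isOpen_image_id_add (hB : IsOpen B) (hconv : Convex ℝ B)
    (hf : DifferentiableOn ℝ f B) (hD : ∀ z ∈ B, ‖fderiv ℝ f z‖ ≤ 1 / 2)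
    (hF : F = fun z => z + f z) : IsOpen (F '' B) :=
  ((approximatesLinearOn_id_add hB hconv hf hD hF).toOpenPartialHomeomorph F B
    half_lt_inv_nnnorm_refl hB).open_target

theorem hasFDerivAt_id_add (hB : IsOpen B) (hf : DifferentiableOn ℝ f B)
    (hF : F = fun z => z + f z) {z : Cn n} (hz : z ∈ B) :
    HasFDerivAt F (1 + fderiv ℝ f z) z := by
  subst hF
  exact (hasFDerivAt_id z).add (hf.differentiableAt (hB.mem_nhds hz)).hasFDerivAt

theorem invFunOn_apply_image (hF : Set.InjOn F B) {z : Cn n} (hz : z ∈ B) :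
    Function.invFunOn F B (F z) = z :=
  hF.leftInvOn_invFunOn hz

theorem invFunOn_id_add_regularity (hB : IsOpen B) (hconv : Convex ℝ B)
    (hf : DifferentiableOn ℝ f B) (hD : ∀ z ∈ B, ‖fderiv ℝ f z‖ ≤ 1 / 2)
    (hF : F = fun z => z + f z) {z : Cn n} (hz : z ∈ B) :
    HasFDerivAt (Function.invFunOn F B) (Ring.inverse (1 + fderiv ℝ f z)) (F z) ∧
      ∀ p : ℕ, ContDiffAt ℝ p f z → ContDiffAt ℝ p (Function.invFunOn F B) (F z) := by
  have happ := approximatesLinearOn_id_add hB hconv hf hD hF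
  have hinj := injOn_id_add hB hconv hf hD hF
  set e := happ.toOpenPartialHomeomorph F B half_lt_inv_nnnorm_refl hB with he
  have het : e.target = F '' B := rfl
  have hmem : F z ∈ e.target := het ▸ Set.mem_image_of_mem F hz
  have hes : ∀ y ∈ B, e.symm (F y) = y := fun y hy => e.left_inv hy
  have heq : Set.EqOn (Function.invFunOn F B) e.symm (F '' B) := by
    rintro _ ⟨y, hy, rfl⟩
    rw [invFunOn_apply_image hinj hy, hes y hy]
  have hev : Function.invFunOn F B =ᶠ[nhds (F z)] e.symm :=
    Filter.eventuallyEq_of_mem (e.open_target.mem_nhds hmem) heq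
  obtain ⟨u, hu⟩ := isUnit_one_add_of_norm_le (hD z hz)
  have hder : HasFDerivAt e (ContinuousLinearEquiv.ofUnit u : Cn n →L[ℝ] Cn n)
      (e.symm (F z)) := by
    rw [hes z hz]
    have := hasFDerivAt_id_add hB hf hF hz
    rw [← hu] at this
    exact this
  constructor
  · rw [← hu, Ring.inverse_unit]
    exact (e.hasFDerivAt_symm hmem hder).congr_of_eventuallyEq hev
  · intro p hp
    refine ContDiffAt.congr_of_eventuallyEq (e.contDiffAt_symm hmem hder ?_) hev
    rw [hes z hz]
    have : ContDiffAt ℝ p F z := by rw [hF]; exact contDiffAt_id.add hp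
    exact this

end Diffeo

/-! ### Tame bounds for the operators of the construction. -/

section TameOperators

variable {ι E : Type} [NormedAddCommGroup E] [NormedSpace ℝ E] {n m N : ℕ}
  {U : ι → Set E} {w v v₁ v₂ v₃ : ι → ℕ → ℝ≥0∞}

/-- `antiPart` as a real linear map. -/
def antiL (n m : ℕ) : (Cn n →L[ℝ] Cn m) →L[ℝ] (Cn n →L[ℂ] Cn m) :=
  holL n m ∘L (ContinuousLinearMap.compL ℝ (Cn n) (Cn n) (Cn m)).flip (conjL n)

/-- The adjoint as a real linear map. -/
def adjL (n m : ℕ) : (Cn n →L[ℂ] Cn m) →L[ℝ] (Cn m →L[ℂ] Cn n) :=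
  LinearMap.mkContinuous
    { toFun := fun R => ContinuousLinearMap.adjoint R
      map_add' := fun R S => map_add _ R S
      map_smul' := fun c R => by
        have h : c • R = (c : ℂ) • R := (Complex.coe_smul c R).symm
        rw [h, map_smulₛₗ, Complex.conj_ofReal, RingHom.id_apply, Complex.coe_smul] } 1
    (fun R => by simp)

theorem TameBound.holPart (hU : ∀ i, IsOpen (U i)) {T : ι → E → (Cn n →L[ℝ] Cn m)}
    (hT : TameBound U N w T) : TameBound U N w (fun i z => holPart (T i z)) :=
  hT.clm hU (holL n m)

theorem TameBound.antiPart (hU : ∀ i, IsOpen (U i)) {T : ι → E → (Cn n →L[ℝ] Cn m)}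
    (hT : TameBound U N w T) : TameBound U N w (fun i z => antiPart (T i z)) :=
  hT.clm hU (antiL n m)

theorem TameBound.conjL_comp (hU : ∀ i, IsOpen (U i)) {T : ι → E → (Cn n →L[ℝ] Cn n)}
    (hT : TameBound U N w T) : TameBound U N w (fun i z => conjL n ∘L T i z) :=
  hT.clm hU (ContinuousLinearMap.compL ℝ (Cn n) (Cn n) (Cn n) (conjL n))

theorem TameBound.four_smul {n m : ℕ} (hU : ∀ i, IsOpen (U i)) {T : ι → E → (Cn n →L[ℂ] Cn m)}
    (hT : TameBound U N w T) : TameBound U N w (fun i z => (4 : ℂ) • T i z) := by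
  refine (hT.clm hU ((4 : ℝ) • ContinuousLinearMap.id ℝ _)).congr hU fun i z _ => ?_
  have : ((4 : ℝ) : ℂ) • T i z = (4 : ℝ) • T i z := Complex.coe_smul 4 (T i z)
  simpa using this

/-- Weights for which bounded powers and products stay bounded. -/
structure IsTameWeight (N : ℕ) (w : ι → ℕ → ℝ≥0∞) : Prop where
  one_le : ∀ i, 1 ≤ w i 0
  mul_le : ∀ i a b, a + b ≤ N → w i a * w i b ≤ w i (a + b)

section

variable (hU : ∀ i, IsOpen (U i)) (hw : IsTameWeight N w)
include hU hw

theorem TameBound.gramErr {R : ι → E → (Cn n →L[ℂ] Cn m)} (hR : TameBound U N w R) :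
    TameBound U N w (fun i z => gramErr (R i z)) :=
  ((hR.clm_comp hU hw.mul_le (hR.clm hU (adjL n m))).four_smul hU).sub hU
    (TameBound.const hw.one_le 1)

theorem TameBound.rightInv {R : ι → E → (Cn n →L[ℂ] Cn m)} (hR : TameBound U N w R)
    (hsmall : ∀ i, ∀ z ∈ U i, ‖_root_.gramErr (R i z)‖ ≤ 1 / 2) :
    TameBound U N w (fun i z => rightInv (R i z)) :=
  ((hR.clm hU (adjL n m)).clm_comp hU hw.mul_le
    ((hR.gramErr hU hw).ringInverse hU hw.one_le hw.mul_le hsmall)).four_smul hU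

theorem TameBound.kerProj {R : ι → E → (Cn n →L[ℂ] Cn m)} (hR : TameBound U N w R)
    (hsmall : ∀ i, ∀ z ∈ U i, ‖_root_.gramErr (R i z)‖ ≤ 1 / 2) :
    TameBound U N w (fun i z => kerProj (R i z)) :=
  (TameBound.const hw.one_le 1).sub hU ((hR.rightInv hU hw hsmall).clm_comp hU hw.mul_le hR)

variable {T : ι → E → (Cn n →L[ℝ] Cn m)} {D : ι → E → (Cn n →L[ℝ] Cn n)}
  {μ q : ι → E → (Cn n →L[ℂ] Cn n)} (hT : TameBound U N w T) (hD : TameBound U N w D)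
  (hμ : TameBound U N w μ) (hs : ∀ i, ∀ z ∈ U i, SmallData (T i z) (D i z) (μ i z))
include hT hs

theorem tameBound_lift : TameBound U N w
    (fun i z => _root_.rightInv (_root_.antiPart (T i z)) ∘L _root_.holPart (T i z)) :=
  ((hT.antiPart hU).rightInv hU hw fun i z hz => (hs i z hz).gram).clm_comp hU hw.mul_le
    (hT.holPart hU)

include hD

theorem tameBound_pushDiff : TameBound U N w (fun i z => pushDiff (T i z) (D i z)) :=
  hT.clm_comp hU hw.mul_le
    (hD.ringInverse hU hw.one_le hw.mul_le fun i z hz => (hs i z hz).diff)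

include hμ

theorem tameBound_frameErr : TameBound U N w (fun i z => frameErr (T i z) (D i z) (μ i z)) := by
  have hP := (tameBound_pushDiff hU hw hT hD hs).antiPart hU
  have hsm : ∀ i, ∀ z ∈ U i, ‖gramErr (antiPart (pushDiff (T i z) (D i z)))‖ ≤ 1 / 2 :=
    fun i z hz => (hs i z hz).gram_push
  have htau : TameBound U N w (fun i z => tauBar (T i z) (μ i z)) :=
    (tameBound_lift hU hw hT hs).clm_comp hU hw.mul_le hμ
  have hcD := hD.conjL_comp hU
  have hpert : TameBound U N w (fun i z => barPert (T i z) (D i z) (μ i z)) :=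
    (htau.add hU ((hcD.antiPart hU).clm_comp hU hw.mul_le
      ((TameBound.const hw.one_le 1).add hU htau))).sub hU
      ((hcD.holPart hU).clm_comp hU hw.mul_le hμ)
  exact ((hP.kerProj hU hw hsm).clm_comp hU hw.mul_le hpert).add hU
    ((hP.rightInv hU hw hsm).clm_comp hU hw.mul_le ((hT.antiPart hU).sub hU hP))

/-- Tame bounds for the coefficients of the image structure, read on the source. -/
theorem tameBound_imageForm (hDv : TameBound U N v₁ D) (hμv : TameBound U N v₂ μ)
    (hqv : TameBound U N v q)
    (hv₁ : ∀ i a b, a + b ≤ N → v₁ i a * w i b ≤ v₁ i (a + b))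
    (hv₁₂ : ∀ i a b, a + b ≤ N → v₁ i a * v₂ i b ≤ v i (a + b))
    (hv : ∀ i a b, a + b ≤ N → v i a * w i b ≤ v i (a + b)) :
    TameBound U N v (fun i z => imageForm (T i z) (D i z) (μ i z) (q i z)) := by
  have hP := (tameBound_pushDiff hU hw hT hD hs).antiPart hU
  have hsm : ∀ i, ∀ z ∈ U i, ‖gramErr (antiPart (pushDiff (T i z) (D i z)))‖ ≤ 1 / 2 :=
    fun i z hz => (hs i z hz).gram_push
  -- The bilinear part of `holImage`: D carries `v₁`, μ carries `v₂`, and the lift is a bounded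
  -- coefficient of weight `w`.
  have hA := (((hDv.antiPart hU).clm_comp hU hv₁ (tameBound_lift hU hw hT hs)).sub hU
    (hDv.holPart hU)).clm_comp hU hv₁₂ hμv
  have hinv := (tameBound_frameErr hU hw hT hD hμ hs).ringInverse hU hw.one_le hw.mul_le
    fun i z hz => (hs i z hz).frame
  exact ((hqv.add hU hA).clm_comp hU hv
    (hinv.clm_comp hU hw.mul_le (hP.kerProj hU hw hsm))).neg hU

end

end TameOperators

/-! ### Admissible data and their basic geometry. -/

section Datum

/-- The data of the problem: the functions `r`, `f` of class `C^{N+1}` and the matrix functions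
`μ`, `q` of class `C^N` on the unit ball, with `r`, `f` small in `C^1` and `μ` small in `C^0`. -/
structure Datum (d m N : ℕ) where
  r : Fin m → Cn (d + m) → ℝ
  f : Cn (d + m) → Cn (d + m)
  μ : Form01 (d + m)
  q : Form01 (d + m)
  contDiffOn_r : ∀ l, ContDiffOn ℝ (N + 1 : ℕ) (r l) (ball 0 1)
  contDiffOn_f : ContDiffOn ℝ (N + 1 : ℕ) f (ball 0 1)
  contDiffOn_μ : ContDiffOn ℝ N μ (ball 0 1)
  contDiffOn_q : ContDiffOn ℝ N q (ball 0 1)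
  small_r : ∀ l, ∀ z ∈ ball (0 : Cn (d + m)) 1, ‖fderiv ℝ (r l) z‖ ≤ 1 / (40 * (m + 1))
  small_f : ∀ z ∈ ball (0 : Cn (d + m)) 1, ‖fderiv ℝ f z‖ ≤ 1 / 1000
  small_μ : ∀ z ∈ ball (0 : Cn (d + m)) 1, ‖μ z‖ ≤ 1 / 1000

variable {d m N : ℕ}

theorem ContDiffOn.differentiableAt_of_succ {V W : Type*} [NormedAddCommGroup V] [NormedSpace ℝ V]
    [NormedAddCommGroup W] [NormedSpace ℝ W] {g : V → W} {U : Set V}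
    (hg : ContDiffOn ℝ (N + 1 : ℕ) g U) (hU : IsOpen U) {z : V} (hz : z ∈ U) :
    DifferentiableAt ℝ g z :=
  (hg.contDiffAt (hU.mem_nhds hz)).differentiableAt (by norm_cast)

theorem contDiffOn_graphDef {p : ℕ} {r : Fin m → Cn (d + m) → ℝ} {U : Set (Cn (d + m))}
    (hr : ∀ l, ContDiffOn ℝ p (r l) U) (l : Fin m) : ContDiffOn ℝ p (graphDef d r l) U := by
  refine ContDiffOn.add ?_ (hr l)
  exact (Complex.imCLM.contDiff.comp
    ((EuclideanSpace.proj (Fin.natAdd d l) : Cn (d + m) →L[ℂ] ℂ).restrictScalars ℝ).contDiff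
    ).contDiffOn

theorem hasFDerivAt_vecDef {n : ℕ} {ρ : Fin m → Cn n → ℝ} {z : Cn n}
    {A : Fin m → (Cn n →L[ℝ] ℝ)} (hρ : ∀ l, HasFDerivAt (ρ l) (A l) z) :
    HasFDerivAt (vecDef ρ) (∑ l, ContinuousLinearMap.toSpanSingleton ℝ
      (EuclideanSpace.single l (1 : ℂ) : Cn m) ∘L A l) z := by
  rw [funext (vecDef_eq_sum ρ)]
  exact HasFDerivAt.fun_sum fun l _ => (ContinuousLinearMap.hasFDerivAt _).comp z (hρ l)

namespace Datum

variable (i : Datum d m N)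

/-- The defining functions of the manifold. -/
def ρ : Fin m → Cn (d + m) → ℝ := graphDef d i.r

/-- The diffeomorphism. -/
def F : Cn (d + m) → Cn (d + m) := fun z => z + i.f z

/-- The inverse diffeomorphism. -/
def Φ : Cn (d + m) → Cn (d + m) := Function.invFunOn i.F (ball 0 1)

/-- The differential of the defining functions. -/
def T (z : Cn (d + m)) : Cn (d + m) →L[ℝ] Cn m := fderiv ℝ (vecDef i.ρ) z

/-- The coefficients of the image structure, as functions on the source. -/
def form : Form01 (d + m) := fun z => imageForm (i.T z) (fderiv ℝ i.f z) (i.μ z) (i.q z)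

/-- The normalized coefficients of the image structure. -/
def ν : Form01 (d + m) := fun w => i.form (i.Φ w)

theorem differentiableAt_ρ (l : Fin m) {z : Cn (d + m)} (hz : z ∈ ball 0 1) :
    DifferentiableAt ℝ (i.ρ l) z :=
  (contDiffOn_graphDef i.contDiffOn_r l).differentiableAt_of_succ isOpen_ball hz

theorem hasFDerivAt_ρ (l : Fin m) {z : Cn (d + m)} (hz : z ∈ ball 0 1) :
    HasFDerivAt (i.ρ l) (Complex.imCLM ∘L ((EuclideanSpace.proj (Fin.natAdd d l) :
      Cn (d + m) →L[ℂ] ℂ).restrictScalars ℝ) + fderiv ℝ (i.r l) z) z :=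
  ((Complex.imCLM ∘L ((EuclideanSpace.proj (Fin.natAdd d l) :
      Cn (d + m) →L[ℂ] ℂ).restrictScalars ℝ)).hasFDerivAt).add
    ((i.contDiffOn_r l).differentiableAt_of_succ isOpen_ball hz).hasFDerivAt

theorem T_eq_sum {z : Cn (d + m)} (hz : z ∈ ball 0 1) :
    i.T z = ∑ l, ContinuousLinearMap.toSpanSingleton ℝ
      (EuclideanSpace.single l (1 : ℂ) : Cn m) ∘L fderiv ℝ (i.ρ l) z :=
  (hasFDerivAt_vecDef fun l => (i.differentiableAt_ρ l hz).hasFDerivAt).fderiv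

theorem T_sub_imPart {z : Cn (d + m)} (hz : z ∈ ball 0 1) :
    i.T z - imPart d m = ∑ l, ContinuousLinearMap.toSpanSingleton ℝ
      (EuclideanSpace.single l (1 : ℂ) : Cn m) ∘L fderiv ℝ (i.r l) z := by
  rw [i.T_eq_sum hz, sub_eq_iff_eq_add]
  ext v j
  simp only [fun l => (i.hasFDerivAt_ρ l hz).fderiv]
  simp [imPart_apply, Finset.sum_apply, Pi.single_apply, Finset.sum_add_distrib, add_comm]

theorem norm_T_sub_imPart_le {z : Cn (d + m)} (hz : z ∈ ball 0 1) :
    ‖i.T z - imPart d m‖ ≤ 1 / 40 := by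
  rw [i.T_sub_imPart hz]
  have h : ∀ l ∈ Finset.univ, ‖ContinuousLinearMap.toSpanSingleton ℝ
      (EuclideanSpace.single l (1 : ℂ) : Cn m) ∘L fderiv ℝ (i.r l) z‖ ≤ 1 / (40 * (m + 1)) := by
    intro l _
    refine (ContinuousLinearMap.opNorm_comp_le _ _).trans ?_
    rw [ContinuousLinearMap.norm_toSpanSingleton]
    simpa using i.small_r l z hz
  -- There are m summands; the m + 1 in `small_r` also makes sense for m = 0.
  refine (norm_sum_le_of_le _ h).trans ?_
  simp only [Finset.sum_const, Finset.card_univ, Fintype.card_fin, nsmul_eq_mul]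
  rw [mul_one_div, div_le_div_iff₀ (by positivity) (by norm_num)]
  linarith

theorem smallData {z : Cn (d + m)} (hz : z ∈ ball 0 1) :
    SmallData (i.T z) (fderiv ℝ i.f z) (i.μ z) :=
  smallData_of_norm_le (i.norm_T_sub_imPart_le hz) (i.small_f z hz) (i.small_μ z hz)

theorem norm_fderiv_ρ_le (l : Fin m) {z : Cn (d + m)} (hz : z ∈ ball 0 1) :
    ‖fderiv ℝ (i.ρ l) z‖ ≤ 2 := by
  rw [(i.hasFDerivAt_ρ l hz).fderiv]
  have h1 : ‖Complex.imCLM ∘L ((EuclideanSpace.proj (Fin.natAdd d l) :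
      Cn (d + m) →L[ℂ] ℂ).restrictScalars ℝ)‖ ≤ 1 :=
    ContinuousLinearMap.opNorm_le_bound _ zero_le_one fun v => by
      rw [one_mul]
      exact (Complex.abs_im_le_norm _).trans (PiLp.norm_apply_le v _)
  have h2 := i.small_r l z hz
  have h3 : 1 / (40 * ((m : ℝ) + 1)) ≤ 1 := by
    rw [div_le_one (by positivity)]
    nlinarith [(Nat.cast_nonneg m : (0 : ℝ) ≤ m)]
  exact (norm_add_le _ _).trans (by linarith)

theorem norm_fderiv_f_le_half : ∀ z ∈ ball (0 : Cn (d + m)) 1, ‖fderiv ℝ i.f z‖ ≤ 1 / 2 :=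
  fun z hz => (i.small_f z hz).trans (by norm_num)

theorem differentiableOn_f : DifferentiableOn ℝ i.f (ball 0 1) :=
  fun _ hz => (i.contDiffOn_f.differentiableAt_of_succ isOpen_ball hz).differentiableWithinAt

theorem injOn_F : Set.InjOn i.F (ball 0 1) :=
  injOn_id_add isOpen_ball (convex_ball _ _) i.differentiableOn_f i.norm_fderiv_f_le_half rfl

theorem isOpen_image : IsOpen (i.F '' ball 0 1) :=
  isOpen_image_id_add isOpen_ball (convex_ball _ _) i.differentiableOn_f i.norm_fderiv_f_le_half rfl

theorem Φ_F {z : Cn (d + m)} (hz : z ∈ ball 0 1) : i.Φ (i.F z) = z :=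
  invFunOn_apply_image i.injOn_F hz

theorem mapsTo_Φ : Set.MapsTo i.Φ (i.F '' ball 0 1) (ball 0 1) := by
  rintro _ ⟨z, hz, rfl⟩
  rwa [i.Φ_F hz]

theorem hasFDerivAt_F {z : Cn (d + m)} (hz : z ∈ ball 0 1) :
    HasFDerivAt i.F (1 + fderiv ℝ i.f z) z :=
  hasFDerivAt_id_add isOpen_ball i.differentiableOn_f rfl hz

theorem hasFDerivAt_Φ {z : Cn (d + m)} (hz : z ∈ ball 0 1) :
    HasFDerivAt i.Φ (Ring.inverse (1 + fderiv ℝ i.f z)) (i.F z) :=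
  (invFunOn_id_add_regularity isOpen_ball (convex_ball _ _) i.differentiableOn_f i.norm_fderiv_f_le_half
    rfl hz).1

theorem contDiffOn_Φ {p : ℕ} (hp : ContDiffOn ℝ p i.f (ball 0 1)) :
    ContDiffOn ℝ p i.Φ (i.F '' ball 0 1) := by
  rintro _ ⟨z, hz, rfl⟩
  exact ((invFunOn_id_add_regularity isOpen_ball (convex_ball _ _) i.differentiableOn_f
    i.norm_fderiv_f_le_half rfl hz).2 p
      (hp.contDiffAt (isOpen_ball.mem_nhds hz))).contDiffWithinAt

theorem mem_ctM_iff {z : Cn (d + m)} (hz : z ∈ ball 0 1) (X : CTan (d + m)) :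
    X ∈ ctM i.ρ z ↔ holPart (i.T z) X.fst + antiPart (i.T z) X.snd = 0 :=
  _root_.mem_ctM_iff (fun l => i.differentiableAt_ρ l hz) X

/-- By the chain rule, ρ ∘ F⁻¹ has differential T(1 + D)⁻¹ at F(z), which is `pushDiff`. -/
theorem mem_ctM_push_iff {z : Cn (d + m)} (hz : z ∈ ball 0 1) (X : CTan (d + m)) :
    X ∈ ctM (pushDef (ball 0 1) i.F i.ρ) (i.F z) ↔
      holPart (pushDiff (i.T z) (fderiv ℝ i.f z)) X.fst
        + antiPart (pushDiff (i.T z) (fderiv ℝ i.f z)) X.snd = 0 := by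
  have hz' : i.Φ (i.F z) ∈ ball 0 1 := by rwa [i.Φ_F hz]
  have hd : ∀ l, DifferentiableAt ℝ (pushDef (ball 0 1) i.F i.ρ l) (i.F z) := fun l =>
    (i.differentiableAt_ρ l hz').comp (i.F z) (i.hasFDerivAt_Φ hz).differentiableAt
  rw [_root_.mem_ctM_iff hd]
  have hv : HasFDerivAt (vecDef i.ρ) (i.T z) (i.Φ (i.F z)) := by
    rw [i.Φ_F hz]
    exact (differentiableAt_vecDef fun l => i.differentiableAt_ρ l hz).hasFDerivAt
  have h := hv.comp (i.F z) (i.hasFDerivAt_Φ hz)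
  have h2 : HasFDerivAt (vecDef (pushDef (ball 0 1) i.F i.ρ)) (pushDiff (i.T z) (fderiv ℝ i.f z))
    (i.F z) := h
  rw [h2.fderiv]

end Datum

end Datum

/-! ### Submultiplicative weights. -/

section TameWeight

/-- Weight for functions of size `e₀` in `C^k` and size `e₁` in higher norms, multiplied by
functions of `C^k`-size `K` and of higher norms `L`. -/
def tameWeight (k : ℕ) (K L e₀ e₁ : ℝ≥0∞) (j : ℕ) : ℝ≥0∞ :=
  K ^ j * (if j ≤ k then e₀ else e₁ + L * e₀)

variable {k s : ℕ} {K L e₀ e₁ g₀ g₁ : ℝ≥0∞}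

/-- As a + b ≤ k + s ≤ 2k, at most one index exceeds k. Only the factor with that index contributes
its high norm, so no product of two high norms appears. -/
theorem tameWeight_mul_le (hs : s ≤ k) (hL : 1 ≤ L) {a b : ℕ} (hab : a + b ≤ k + s) :
    tameWeight k K L e₀ e₁ a * tameWeight k K L g₀ g₁ b
      ≤ tameWeight k K L (e₀ * g₀) (e₁ * g₀ + e₀ * g₁) (a + b) := by
  have e : tameWeight k K L e₀ e₁ a * tameWeight k K L g₀ g₁ b = K ^ (a + b) *
      ((if a ≤ k then e₀ else e₁ + L * e₀) * (if b ≤ k then g₀ else g₁ + L * g₀)) := by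
    rw [tameWeight, tameWeight, pow_add]; ring
  rw [e, tameWeight]
  refine mul_le_mul_right ?_ _
  by_cases ha : a ≤ k
  · by_cases hb : b ≤ k
    · rw [if_pos ha, if_pos hb]
      split_ifs
      · exact le_rfl
      · exact le_add_left (le_mul_of_one_le_left zero_le hL)
    · rw [if_pos ha, if_neg hb, if_neg (by omega)]
      calc e₀ * (g₁ + L * g₀) = e₀ * g₁ + L * (e₀ * g₀) := by ring
        _ ≤ _ := add_le_add_left (le_add_left le_rfl) _
  · have hb : b ≤ k := by omega
    rw [if_neg ha, if_pos hb, if_neg (by omega)]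
    calc (e₁ + L * e₀) * g₀ = e₁ * g₀ + L * (e₀ * g₀) := by ring
      _ ≤ _ := add_le_add_left (le_add_right le_rfl) _

theorem tameWeight_mul_one_le (hs : s ≤ k) (hL : 1 ≤ L) {a b : ℕ} (hab : a + b ≤ k + s) :
    tameWeight k K L e₀ e₁ a * tameWeight k K L 1 0 b ≤ tameWeight k K L e₀ e₁ (a + b) := by
  simpa using tameWeight_mul_le (K := K) (e₀ := e₀) (e₁ := e₁) (g₀ := 1) (g₁ := 0) hs hL hab

theorem tameWeight_mono (he : e₀ ≤ g₀) (hg : e₁ ≤ g₁) (j : ℕ) :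
    tameWeight k K L e₀ e₁ j ≤ tameWeight k K L g₀ g₁ j := by
  unfold tameWeight
  refine mul_le_mul_right ?_ _
  split_ifs
  · exact he
  · exact add_le_add hg (mul_le_mul_right he _)

theorem isTameWeight_tameWeight {ι : Type} {K L : ι → ℝ≥0∞} (hs : s ≤ k) (hL : ∀ i, 1 ≤ L i) :
    IsTameWeight (k + s) (fun i => tameWeight k (K i) (L i) 1 0) where
  one_le i := by simp [tameWeight]
  mul_le i a b hab := tameWeight_mul_one_le hs (hL i) hab

variable {ι E V : Type} [NormedAddCommGroup E] [NormedSpace ℝ E] [NormedAddCommGroup V]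
  [NormedSpace ℝ V] {U : ι → Set E} {u : ι → E → V}

theorem tameBound_of_le {K L e₀ e₁ : ι → ℝ≥0∞} (hK : ∀ i, 1 ≤ K i)
    (hu : ∀ i, ContDiffOn ℝ (k + s : ℕ) (u i) (U i))
    (h₀ : ∀ i, ∀ j ≤ k, ∀ z ∈ U i, ‖iteratedFDeriv ℝ j (u i) z‖ₑ ≤ e₀ i)
    (h₁ : ∀ i, ∀ j ≤ k + s, ∀ z ∈ U i, ‖iteratedFDeriv ℝ j (u i) z‖ₑ ≤ e₁ i) :
    TameBound U (k + s) (fun i => tameWeight k (K i) (L i) (e₀ i) (e₁ i)) u := by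
  refine ⟨1, fun i => ⟨hu i, fun j hj z hz => ?_⟩⟩
  rw [ENNReal.coe_one, one_mul]
  beta_reduce
  rw [tameWeight]
  refine le_trans ?_ (le_mul_of_one_le_left zero_le (one_le_pow₀ (hK i)))
  split_ifs with h
  · exact h₀ i j h z hz
  · exact (h₁ i j hj z hz).trans le_self_add

/-- At order zero the weight is 1, so the a priori bound `C` is needed; from order one on, K ≤ K^j
suffices. -/
theorem tameBound_one_of_le {K L : ι → ℝ≥0∞} (hK : ∀ i, 1 ≤ K i)
    (hu : ∀ i, ContDiffOn ℝ (k + s : ℕ) (u i) (U i)) (C : ℝ≥0)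
    (hC : ∀ i, ∀ z ∈ U i, ‖u i z‖ ≤ C)
    (h₀ : ∀ i, ∀ j ≤ k, ∀ z ∈ U i, ‖iteratedFDeriv ℝ j (u i) z‖ₑ ≤ K i)
    (h₁ : ∀ i, ∀ j ≤ k + s, ∀ z ∈ U i, ‖iteratedFDeriv ℝ j (u i) z‖ₑ ≤ L i) :
    TameBound U (k + s) (fun i => tameWeight k (K i) (L i) 1 0) u := by
  refine ⟨max C 1, fun i => ⟨hu i, fun j hj z hz => ?_⟩⟩
  beta_reduce
  rw [tameWeight]
  have h1 : (1 : ℝ≥0∞) ≤ (max C 1 : ℝ≥0) := by exact_mod_cast le_max_right C 1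
  rcases Nat.eq_zero_or_pos j with rfl | hpos
  · rw [enorm_iteratedFDeriv_zero]
    simp only [pow_zero, zero_le, if_true, mul_one]
    refine le_trans ?_ (ENNReal.coe_le_coe.2 (le_max_left C 1))
    exact ENNReal.coe_le_coe.2 (hC i z hz)
  · refine le_trans ?_ (le_mul_of_one_le_left zero_le h1)
    split_ifs with h
    · rw [mul_one]
      exact (h₀ i j h z hz).trans (le_self_pow₀ (hK i) hpos.ne')
    · rw [zero_add, mul_one]
      exact (h₁ i j hj z hz).trans (le_mul_of_one_le_left zero_le (one_le_pow₀ (hK i)))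

end TameWeight

/-! ### Elementary properties of the C^k norms. -/

section CkNorm

variable {E V : Type*} [NormedAddCommGroup E] [NormedSpace ℝ E] [NormedAddCommGroup V]
  [NormedSpace ℝ V] {U : Set E} {φ : E → V}

theorem enorm_iteratedFDeriv_le_ckNorm {j k : ℕ} (hj : j ≤ k) {z : E} (hz : z ∈ U) :
    ‖iteratedFDeriv ℝ j φ z‖ₑ ≤ ckNorm U k φ := by
  unfold ckNorm
  split_ifs
  · exact le_iSup₂_of_le z hz (le_iSup₂_of_le j hj le_rfl)
  · exact le_top

theorem ckNorm_le {k : ℕ} {C : ℝ≥0∞} (hφ : ContDiffOn ℝ k φ U)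
    (h : ∀ j ≤ k, ∀ z ∈ U, ‖iteratedFDeriv ℝ j φ z‖ₑ ≤ C) : ckNorm U k φ ≤ C := by
  unfold ckNorm
  rw [if_pos hφ]
  exact iSup₂_le fun z hz => iSup₂_le fun j hj => h j hj z hz

theorem ckNorm_eq_top {k : ℕ} (hφ : ¬ ContDiffOn ℝ k φ U) : ckNorm U k φ = ⊤ := by
  unfold ckNorm
  rw [if_neg hφ]

theorem ckNorm_le_ckNormFam {m k : ℕ} (ρ : Fin m → E → V) (l : Fin m) :
    ckNorm U k (ρ l) ≤ ckNormFam U k ρ := le_iSup (fun l => ckNorm U k (ρ l)) l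

theorem norm_le_of_ckNorm_lt {k : ℕ} {ε : ℝ≥0} (h : ckNorm U k φ < ε) {z : E} (hz : z ∈ U) :
    ‖φ z‖ ≤ ε := by
  have h1 := (enorm_iteratedFDeriv_le_ckNorm (φ := φ) (Nat.zero_le k) hz).trans h.le
  rw [← ofReal_norm, norm_iteratedFDeriv_zero, ofReal_norm] at h1
  exact ENNReal.coe_le_coe.1 h1

theorem norm_fderiv_le_of_ckNorm_lt {k : ℕ} (hk : 1 ≤ k) {ε : ℝ≥0} (h : ckNorm U k φ < ε) {z : E}
    (hz : z ∈ U) : ‖fderiv ℝ φ z‖ ≤ ε := by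
  have h1 := (enorm_iteratedFDeriv_le_ckNorm (φ := φ) hk hz).trans h.le
  rw [← ofReal_norm, ← norm_iteratedFDeriv_fderiv, norm_iteratedFDeriv_zero, ofReal_norm] at h1
  exact ENNReal.coe_le_coe.1 h1

end CkNorm

/-! ### The tame estimate for the image structure. -/

namespace Datum

variable {d m k s N : ℕ}

/-- The factor of the estimates that depends on the lower norms. -/
def lowNorm (k : ℕ) (i : Datum d m N) : ℝ≥0∞ :=
  1 + ckNormFam (ball 0 1) (k + 2) i.ρ + ckNorm (ball 0 1) (k + 1) i.f + ckNorm (ball 0 1) k i.μ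

theorem one_le_lowNorm (k : ℕ) (i : Datum d m N) : 1 ≤ lowNorm k i :=
  le_add_right (le_add_right le_self_add)

theorem ckNormFam_le_lowNorm (k : ℕ) (i : Datum d m N) :
    ckNormFam (ball 0 1) (k + 2) i.ρ ≤ lowNorm k i :=
  le_add_right (le_add_right le_add_self)

theorem ckNorm_f_le_lowNorm (k : ℕ) (i : Datum d m N) :
    ckNorm (ball 0 1) (k + 1) i.f ≤ lowNorm k i := le_add_right le_add_self

theorem ckNorm_μ_le_lowNorm (k : ℕ) (i : Datum d m N) :
    ckNorm (ball 0 1) k i.μ ≤ lowNorm k i := le_add_self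

/-- The linear size of the estimates in low norms. -/
def lowSize (k : ℕ) (i : Datum d m N) : ℝ≥0∞ :=
  ckNorm (ball 0 1) k i.q + ckNorm (ball 0 1) (k + 1) i.f * ckNorm (ball 0 1) k i.μ

/-- The linear size of the estimates in high norms. -/
def highSize (k s : ℕ) (i : Datum d m N) : ℝ≥0∞ :=
  ckNorm (ball 0 1) (k + s) i.q + ckNorm (ball 0 1) (k + s + 1) i.f * ckNorm (ball 0 1) k i.μ
    + ckNorm (ball 0 1) (k + 1) i.f * ckNorm (ball 0 1) (k + s) i.μ

theorem mul_le_lowSize (k : ℕ) (i : Datum d m N) :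
    ckNorm (ball 0 1) (k + 1) i.f * ckNorm (ball 0 1) k i.μ ≤ lowSize k i := le_add_self

theorem mul_add_mul_le_highSize (k s : ℕ) (i : Datum d m N) :
    ckNorm (ball 0 1) (k + s + 1) i.f * ckNorm (ball 0 1) k i.μ
      + ckNorm (ball 0 1) (k + 1) i.f * ckNorm (ball 0 1) (k + s) i.μ ≤ highSize k s i := by
  unfold highSize
  exact le_add_self.trans (add_assoc _ _ _).ge

theorem contDiffOn_fderiv {V : Type} [NormedAddCommGroup V] [NormedSpace ℝ V]
    {g : Cn (d + m) → V} (hg : ContDiffOn ℝ (N + 1 : ℕ) g (ball 0 1)) :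
    ContDiffOn ℝ N (fderiv ℝ g) (ball 0 1) :=
  hg.fderiv_of_isOpen isOpen_ball (by norm_cast)

/-- Bootstrap on DΦ = (1 + Df)⁻¹ ∘ Φ: bounding the right side to order M requires DΦ only to order M
- 1. -/
theorem tameBound_Φ {w : Datum d m N → ℕ → ℝ≥0∞} (hw : IsTameWeight N w)
    (hD : TameBound (fun _ => ball 0 1) N w (fun i : Datum d m N => fderiv ℝ i.f)) :
    TameBound (fun i : Datum d m N => i.F '' ball 0 1) N w (fun i => fderiv ℝ i.Φ) := by
  have hB : ∀ i : Datum d m N, IsOpen (ball (0 : Cn (d + m)) 1) := fun _ => isOpen_ball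
  have hinv : TameBound (fun _ => ball 0 1) N w
      (fun (i : Datum d m N) z => Ring.inverse (1 + fderiv ℝ i.f z)) :=
    hD.ringInverse hB hw.one_le hw.mul_le fun i z hz => i.norm_fderiv_f_le_half z hz
  have hdiff : ∀ i : Datum d m N, DifferentiableOn ℝ i.Φ (i.F '' ball 0 1) := by
    rintro i _ ⟨z, hz, rfl⟩
    exact (i.hasFDerivAt_Φ hz).differentiableAt.differentiableWithinAt
  have hstep : ∀ M ≤ N, TameBound (fun i : Datum d m N => i.F '' ball 0 1) (M - 1) w
      (fun i => fderiv ℝ i.Φ) →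
      TameBound (fun i : Datum d m N => i.F '' ball 0 1) M w (fun i => fderiv ℝ i.Φ) := by
    intro M hM h
    have := TameBound.comp hB (fun i => i.isOpen_image) (fun i => i.mapsTo_Φ) hdiff M h
      (fun i a b hab => hw.mul_le i (a + 1) b (by omega)) (hinv.mono_order hM)
    refine this.congr (fun i => i.isOpen_image) ?_
    rintro i _ ⟨z, hz, rfl⟩
    simp only [i.Φ_F hz]
    exact (i.hasFDerivAt_Φ hz).fderiv
  have hzero : TameBound (fun i : Datum d m N => i.F '' ball 0 1) 0 w
      (fun i => fderiv ℝ i.Φ) := by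
    refine tameBound_zero.2 ⟨?_, fun i => ?_⟩
    · obtain ⟨C, hC⟩ := hinv.bound_zero
      refine ⟨C, ?_⟩
      rintro i _ ⟨z, hz, rfl⟩
      rw [(i.hasFDerivAt_Φ hz).fderiv]
      exact hC i z hz
    · have h1 := i.contDiffOn_Φ (p := 1) (i.contDiffOn_f.of_le (by norm_cast; omega))
      exact h1.continuousOn_fderiv_of_isOpen i.isOpen_image (by norm_num)
  suffices H : ∀ M ≤ N, TameBound (fun i : Datum d m N => i.F '' ball 0 1) M w
      (fun i => fderiv ℝ i.Φ) from H N le_rfl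
  intro M
  induction M with
  | zero => exact fun _ => hzero
  | succ M ih => exact fun hM => hstep (M + 1) hM (ih (by omega))

/-- The tame estimate for the image structure. -/
theorem tameBound_ν (d m : ℕ) (hs : s ≤ k) :
    TameBound (fun i : Datum d m (k + s) => i.F '' ball 0 1) (k + s)
      (fun i => tameWeight k (lowNorm k i) (lowNorm (k + s) i) (lowSize k i) (highSize k s i))
      (fun i => i.ν) := by
  have hB : ∀ i : Datum d m (k + s), IsOpen (ball (0 : Cn (d + m)) 1) := fun _ => isOpen_ball
  have hK : ∀ i : Datum d m (k + s), 1 ≤ lowNorm k i := one_le_lowNorm k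
  have hL : ∀ i : Datum d m (k + s), 1 ≤ lowNorm (k + s) i := one_le_lowNorm (k + s)
  have hw := isTameWeight_tameWeight (K := fun i : Datum d m (k + s) => lowNorm k i) hs hL
  have hDρ : ∀ l, TameBound (fun _ => ball 0 1) (k + s)
      (fun i : Datum d m (k + s) => tameWeight k (lowNorm k i) (lowNorm (k + s) i) 1 0)
      (fun i => fderiv ℝ (i.ρ l)) := by
    intro l
    refine tameBound_one_of_le hK
      (fun i => contDiffOn_fderiv (contDiffOn_graphDef i.contDiffOn_r l)) 2
      (fun i z hz => i.norm_fderiv_ρ_le l hz) (fun i j hj z hz => ?_) (fun i j hj z hz => ?_)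
    · rw [enorm_iteratedFDeriv_fderiv]
      exact (enorm_iteratedFDeriv_le_ckNorm (show j + 1 ≤ k + 2 by omega) hz).trans
        ((ckNorm_le_ckNormFam _ l).trans (i.ckNormFam_le_lowNorm k))
    · rw [enorm_iteratedFDeriv_fderiv]
      exact (enorm_iteratedFDeriv_le_ckNorm (show j + 1 ≤ k + s + 2 by omega) hz).trans
        ((ckNorm_le_ckNormFam _ l).trans (i.ckNormFam_le_lowNorm (k + s)))
  have hT : TameBound (fun _ => ball 0 1) (k + s)
      (fun i : Datum d m (k + s) => tameWeight k (lowNorm k i) (lowNorm (k + s) i) 1 0)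
      (fun i => i.T) := by
    refine (TameBound.sum hB Finset.univ fun l => (hDρ l).clm hB
      (ContinuousLinearMap.compL ℝ (Cn (d + m)) ℝ (Cn m)
        (ContinuousLinearMap.toSpanSingleton ℝ (EuclideanSpace.single l (1 : ℂ) : Cn m)))).congr
      hB fun i z hz => ?_
    exact i.T_eq_sum hz
  have hDf₀ : ∀ i : Datum d m (k + s), ∀ j ≤ k, ∀ z ∈ ball (0 : Cn (d + m)) 1,
      ‖iteratedFDeriv ℝ j (fderiv ℝ i.f) z‖ₑ ≤ ckNorm (ball 0 1) (k + 1) i.f := by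
    intro i j hj z hz
    rw [enorm_iteratedFDeriv_fderiv]
    exact enorm_iteratedFDeriv_le_ckNorm (by omega) hz
  have hDf₁ : ∀ i : Datum d m (k + s), ∀ j ≤ k + s, ∀ z ∈ ball (0 : Cn (d + m)) 1,
      ‖iteratedFDeriv ℝ j (fderiv ℝ i.f) z‖ₑ ≤ ckNorm (ball 0 1) (k + s + 1) i.f := by
    intro i j hj z hz
    rw [enorm_iteratedFDeriv_fderiv]
    exact enorm_iteratedFDeriv_le_ckNorm (by omega) hz
  have hD : TameBound (fun _ => ball 0 1) (k + s)
      (fun i : Datum d m (k + s) => tameWeight k (lowNorm k i) (lowNorm (k + s) i) 1 0)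
      (fun i => fderiv ℝ i.f) :=
    tameBound_one_of_le hK (fun i => contDiffOn_fderiv i.contDiffOn_f) 1
      (fun i z hz => (i.small_f z hz).trans (by norm_num))
      (fun i j hj z hz => (hDf₀ i j hj z hz).trans (i.ckNorm_f_le_lowNorm k))
      (fun i j hj z hz => (hDf₁ i j hj z hz).trans (i.ckNorm_f_le_lowNorm (k + s)))
  have hμ : TameBound (fun _ => ball 0 1) (k + s)
      (fun i : Datum d m (k + s) => tameWeight k (lowNorm k i) (lowNorm (k + s) i) 1 0)
      (fun i => i.μ) :=
    tameBound_one_of_le hK (fun i => i.contDiffOn_μ) 1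
      (fun i z hz => (i.small_μ z hz).trans (by norm_num))
      (fun i j hj z hz => (enorm_iteratedFDeriv_le_ckNorm hj hz).trans (i.ckNorm_μ_le_lowNorm k))
      (fun i j hj z hz =>
        (enorm_iteratedFDeriv_le_ckNorm hj hz).trans (i.ckNorm_μ_le_lowNorm (k + s)))
  -- Here D and μ are given their own norms as sizes, so that their product falls under `lowSize`
  -- and `highSize`, like q.
  have hform := tameBound_imageForm hB hw hT hD hμ (q := fun i => i.q)
    (fun i z hz => i.smallData hz)
    (tameBound_of_le (L := fun i => lowNorm (k + s) i) hK
      (fun i => contDiffOn_fderiv i.contDiffOn_f) hDf₀ hDf₁)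
    (tameBound_of_le (L := fun i => lowNorm (k + s) i) hK (fun i => i.contDiffOn_μ)
      (fun i j hj z hz => enorm_iteratedFDeriv_le_ckNorm hj hz)
      (fun i j hj z hz => enorm_iteratedFDeriv_le_ckNorm hj hz))
    ((tameBound_of_le (L := fun i => lowNorm (k + s) i) hK (fun i => i.contDiffOn_q)
      (fun i j hj z hz => enorm_iteratedFDeriv_le_ckNorm hj hz)
      (fun i j hj z hz => enorm_iteratedFDeriv_le_ckNorm hj hz)).mono_weight
        (w₂ := fun i => tameWeight k (lowNorm k i) (lowNorm (k + s) i) (lowSize k i)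
          (highSize k s i))
        fun i j _ => tameWeight_mono le_self_add (le_add_right le_self_add) j)
    (fun i a b hab => tameWeight_mul_one_le hs (hL i) hab)
    (fun i a b hab => (tameWeight_mul_le hs (hL i) hab).trans
      (tameWeight_mono (i.mul_le_lowSize k) (i.mul_add_mul_le_highSize k s) _))
    (fun i a b hab => tameWeight_mul_one_le hs (hL i) hab)
  refine TameBound.comp hB (fun i => i.isOpen_image) (fun i => i.mapsTo_Φ) ?_ (k + s)
    ((tameBound_Φ hw hD).mono_order (Nat.sub_le _ _))
    (fun i a b hab => tameWeight_mul_one_le hs (hL i) hab) hform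
  rintro i _ ⟨z, hz, rfl⟩
  exact (i.hasFDerivAt_Φ hz).differentiableAt.differentiableWithinAt

end Datum

/-! ### The constructed matrix represents every admissible μ*. -/

namespace Datum

variable {d m N : ℕ} (i : Datum d m N)

/-- The matrix function `q` represents the form `∂̄_M f - μ`. -/
def Represents : Prop :=
  ∀ z ∈ zeroLocus (ball 0 1) i.ρ, ∀ b, antiPart (i.T z) b = 0 →
    i.q z b = antiPart (fderiv ℝ i.f z) b - i.μ z b

variable {i}

theorem represents_of_representsDbarSub
    (h : RepresentsDbarSub i.ρ (zeroLocus (ball 0 1) i.ρ) i.f i.μ i.q) : i.Represents := by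
  intro z hz b hb
  have := h z hz (WithLp.toLp 2 (0, b)) ((mem_t01M_iff (i.mem_ctM_iff hz.1) _).2 ⟨rfl, hb⟩)
  rw [cdiff_eq] at this
  simpa using this

theorem ν_F {z : Cn (d + m)} (hz : z ∈ ball 0 1) : i.ν (i.F z) = i.form z := by
  rw [ν, i.Φ_F hz]

theorem pushesTo_iff (hq : i.Represents) (μs : Form01 (d + m)) :
    PushesTo (ball 0 1) i.F i.ρ i.μ μs ↔ ∀ z ∈ zeroLocus (ball 0 1) i.ρ, ∀ b,
      antiPart (i.T z) b = 0 → μs (i.F z) (b + frameErr (i.T z) (fderiv ℝ i.f z) (i.μ z) b)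
        = -holImage (i.T z) (fderiv ℝ i.f z) (i.μ z) (i.q z) b :=
  forall₂_congr fun z hz => image_almostCR_iff (i.smallData hz.1)
    (i.hasFDerivAt_F hz.1).differentiableAt (i.hasFDerivAt_F hz.1).fderiv
    (i.mem_ctM_iff hz.1) (i.mem_ctM_push_iff hz.1) (hq z hz)

theorem pushesTo_ν (hq : i.Represents) : PushesTo (ball 0 1) i.F i.ρ i.μ i.ν := by
  refine (pushesTo_iff hq _).2 fun z hz b hb => ?_
  rw [ν_F hz.1]
  exact (i.smallData hz.1).imageForm_frame hb

/-- Both forms have the same prescribed values on (1 + E)T''(M), which is all of T''(M*). -/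
theorem sameForm_ν (hq : i.Represents) {μs : Form01 (d + m)}
    (hμs : PushesTo (ball 0 1) i.F i.ρ i.μ μs) :
    SameForm (pushDef (ball 0 1) i.F i.ρ) (i.F '' zeroLocus (ball 0 1) i.ρ) μs i.ν := by
  rintro _ ⟨z, hz, rfl⟩ Z hZ
  obtain ⟨-, hβ⟩ := (mem_t01M_iff (i.mem_ctM_push_iff hz.1) Z).1 hZ
  obtain ⟨hb, hbβ⟩ := (i.smallData hz.1).exists_preimage hβ
  have h1 := (pushesTo_iff hq _).1 hμs z hz _ hb
  have h2 := (pushesTo_iff hq _).1 (pushesTo_ν hq) z hz _ hb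
  rw [hbβ] at h1 h2
  rw [h1, h2]

theorem isNormalized_ν (i : Datum d m N) :
    IsNormalized (pushDef (ball 0 1) i.F i.ρ) (i.F '' zeroLocus (ball 0 1) i.ρ) i.ν := by
  rintro _ ⟨z, hz, rfl⟩ Z ⟨-, hZ⟩
  have hk := kerProj_of_orthogonal (i.smallData hz.1).gram_push
    ((mem_t01M_orthogonal_iff (i.mem_ctM_push_iff hz.1) Z).1 hZ)
  rw [ν_F hz.1]
  simp [form, imageForm, hk]

end Datum

/-! ### Assembling the estimates. -/

theorem tameWeight_le {k s j : ℕ} {K L e₀ e₁ : ℝ≥0∞} (hs : s ≤ k) (hK : 1 ≤ K) (hL : 1 ≤ L)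
    (hj : j ≤ k + s) : tameWeight k K L e₀ e₁ j ≤ K ^ (2 * k) * (e₁ + L * e₀) := by
  rw [tameWeight]
  refine mul_le_mul' (pow_le_pow_right₀ hK (by omega)) ?_
  split_ifs
  · exact le_add_left (le_mul_of_one_le_left zero_le hL)
  · exact le_rfl

theorem tameWeight_le_of_le {k j : ℕ} {K L e₀ e₁ : ℝ≥0∞} (hK : 1 ≤ K) (hj : j ≤ k) :
    tameWeight k K L e₀ e₁ j ≤ K ^ (2 * k) * e₀ := by
  rw [tameWeight, if_pos hj]
  exact mul_le_mul_left (pow_le_pow_right₀ hK (by omega)) _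

theorem proposition5p4 (d m : ℕ) :
    ∃ P : Polynomial ℕ, ∀ k : ℕ, 2 ≤ k →
      ∃ δ : ℝ≥0, 0 < δ ∧ ∃ ε : ℝ≥0, 0 < ε ∧ ∃ C : ℝ≥0,
        ∀ s p : ℕ, 2 ≤ s → s ≤ k → k + s < p →
        ∀ (r : Fin m → Cn (d + m) → ℝ) (f : Cn (d + m) → Cn (d + m)) (μ : Form01 (d + m))
          (B : Set (Cn (d + m))), B = ball 0 1 →
        (∀ l, ContDiffOn ℝ p (r l) B) → ContDiffOn ℝ p f B → ContDiffOn ℝ p μ B →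
        (∀ l, ckNorm B 1 (r l) < δ) → ckNorm B k μ < ε → ckNorm B (k + 1) f < ε →
        ∀ (ρ ρs : Fin m → Cn (d + m) → ℝ) (F : Cn (d + m) → Cn (d + m))
          (M Ms : Set (Cn (d + m))),
        ρ = graphDef d r → F = (fun z => z + f z) → ρs = pushDef B F ρ →
        M = zeroLocus B ρ → Ms = F '' M →
        -- `F` is a diffeomorphism of the ball onto an open set
        (Set.InjOn F B ∧ IsOpen (F '' B) ∧ ContDiffOn ℝ p (Function.invFunOn F B) (F '' B)) ∧
        -- the pushed-forward structure is given by a form `μ*` on `F(M)`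
        (∃ μs : Form01 (d + m), ContDiffOn ℝ (p - 1 : ℕ) μs (F '' B) ∧ PushesTo B F ρ μ μs) ∧
        -- any such form satisfies the tame estimates
        (∀ μs : Form01 (d + m), PushesTo B F ρ μ μs →
          ∀ q : Form01 (d + m), RepresentsDbarSub ρ M f μ q →
          ∃ ν : Form01 (d + m), SameForm ρs Ms μs ν ∧ IsNormalized ρs Ms ν ∧
            ckNorm (F '' B) k ν ≤
              C * (1 + ckNormFam B (k + 2) ρ + ckNorm B (k + 1) f + ckNorm B k μ) ^ P.eval k
                * (ckNorm B k q + ckNorm B (k + 1) f * ckNorm B k μ) ∧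
            ckNorm (F '' B) (k + s) ν ≤
              C * (1 + ckNormFam B (k + 2) ρ + ckNorm B (k + 1) f + ckNorm B k μ) ^ P.eval k
                * (ckNorm B (k + s) q + ckNorm B (k + s + 1) f * ckNorm B k μ
                  + ckNorm B (k + 1) f * ckNorm B (k + s) μ
                  + (1 + ckNormFam B (k + s + 2) ρ + ckNorm B (k + s + 1) f + ckNorm B (k + s) μ)
                    * (ckNorm B k q + ckNorm B (k + 1) f * ckNorm B k μ))) := by
  -- The exponent 2k dominates every derivative order j ≤ k + s.
  refine ⟨Polynomial.C 2 * Polynomial.X, fun k hk => ?_⟩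
  have hP : (Polynomial.C 2 * Polynomial.X : Polynomial ℕ).eval k = 2 * k := by simp
  rw [hP]
  have hex : ∀ s, ∃ C : ℝ≥0, s ≤ k → ∀ i : Datum d m (k + s),
      ContDiffOn ℝ (k + s : ℕ) i.ν (i.F '' ball 0 1) ∧
      ∀ j ≤ k + s, ∀ z ∈ i.F '' ball 0 1, ‖iteratedFDeriv ℝ j i.ν z‖ₑ ≤
        C * tameWeight k (i.lowNorm k) (i.lowNorm (k + s)) (i.lowSize k) (i.highSize k s) j := by
    intro s
    by_cases hs : s ≤ k
    · obtain ⟨C, hC⟩ := Datum.tameBound_ν d m hs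
      exact ⟨C, fun _ => hC⟩
    · exact ⟨0, fun h => absurd h hs⟩
  choose Cs hCs using hex
  -- Summing over s ≤ k makes the constant depend on k only; s = 0 is included for the C^k estimate.
  -- The added 1 keeps it nonzero, so that it times ∞ is ∞.
  set C : ℝ≥0 := ∑ s ∈ Finset.range (k + 1), Cs s + 1 with hCdef
  have hCsC : ∀ s ≤ k, (Cs s : ℝ≥0∞) ≤ C := fun s hs => ENNReal.coe_le_coe.2
    ((Finset.single_le_sum (fun _ _ => zero_le) (Finset.mem_range.2 (by omega))).trans
      le_self_add)
  have hC0 : (C : ℝ≥0∞) ≠ 0 := by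
    rw [ENNReal.coe_ne_zero]; positivity
  refine ⟨1 / (40 * (m + 1)), by positivity, 1 / 1000, by positivity, C, ?_⟩
  rintro s p hs2 hsk hp r f μ B rfl hr hf hμ hrs hμs' hfs ρ ρs F M Ms rfl rfl rfl rfl rfl
  have hsmall_r : ∀ l, ∀ z ∈ ball (0 : Cn (d + m)) 1,
      ‖fderiv ℝ (r l) z‖ ≤ 1 / (40 * ((m : ℝ) + 1)) := fun l z hz => by
    simpa using norm_fderiv_le_of_ckNorm_lt le_rfl (hrs l) hz
  have hsmall_f : ∀ z ∈ ball (0 : Cn (d + m)) 1, ‖fderiv ℝ f z‖ ≤ 1 / 1000 := fun z hz => by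
    simpa using norm_fderiv_le_of_ckNorm_lt (by omega) hfs hz
  have hsmall_μ : ∀ z ∈ ball (0 : Cn (d + m)) 1, ‖μ z‖ ≤ 1 / 1000 := fun z hz => by
    simpa using norm_le_of_ckNorm_lt hμs' hz
  have mk : ∀ (N : ℕ), N + 1 ≤ p → ∀ q : Form01 (d + m), ContDiffOn ℝ N q (ball 0 1) →
      ∃ i : Datum d m N, i.r = r ∧ i.f = f ∧ i.μ = μ ∧ i.q = q := fun N hN q hq =>
    ⟨⟨r, f, μ, q, fun l => (hr l).of_le (by exact_mod_cast hN), hf.of_le (by exact_mod_cast hN),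
      hμ.of_le (by exact_mod_cast (by omega : N ≤ p)), hq, hsmall_r, hsmall_f, hsmall_μ⟩,
      rfl, rfl, rfl, rfl⟩
  -- the datum with the standard representative of `∂̄f - μ`
  obtain ⟨i, hir, hif, hiμ, hiq⟩ := mk (p - 1) (by omega)
    (fun z => antiPart (fderiv ℝ f z) - μ z) (by
      refine ContDiffOn.sub ?_ (hμ.of_le (by exact_mod_cast Nat.sub_le p 1))
      exact (antiL (d + m) (d + m)).contDiff.comp_contDiffOn
        (hf.fderiv_of_isOpen isOpen_ball (by norm_cast; omega)))
  have hrep : i.Represents := by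
    intro z _ b _
    rw [hiq, hif, hiμ]; rfl
  have hF : i.F = fun z => z + f z := by rw [← hif]; rfl
  have hρ : i.ρ = graphDef d r := by rw [← hir]; rfl
  rw [← hF, ← hρ]
  refine ⟨⟨i.injOn_F, i.isOpen_image, i.contDiffOn_Φ (hif ▸ hf)⟩, ⟨i.ν, ?_, ?_⟩, ?_⟩
  -- With s = 0 and k replaced by p - 1, the tame bound contains the required C^{p-1} regularity.
  · exact (Datum.tameBound_ν (s := 0) (k := p - 1) d m (Nat.zero_le _)).contDiffOn i
  · rw [← hiμ]; exact Datum.pushesTo_ν hrep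
  intro μs hμs q hq
  have hK0 : ∀ (x y z : ℝ≥0∞), (C : ℝ≥0∞) * (1 + x + y + z) ^ (2 * k) ≠ 0 := fun x y z => by
    refine mul_ne_zero hC0 (pow_ne_zero _ ?_)
    simp
  -- If q is not C^k, both right-hand sides are infinite, and the ν built from the standard
  -- representative of ∂̄f - μ serves.
  by_cases hqk : ContDiffOn ℝ k q (ball 0 1)
  swap
  · refine ⟨i.ν, Datum.sameForm_ν hrep (hiμ ▸ hμs), i.isNormalized_ν, ?_, ?_⟩
    · rw [ckNorm_eq_top hqk, top_add, ENNReal.mul_top (hK0 _ _ _)]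
      exact le_top
    · rw [ckNorm_eq_top fun h => hqk (h.of_le (by exact_mod_cast Nat.le_add_right k s)), top_add,
        top_add, top_add, ENNReal.mul_top (hK0 _ _ _)]
      exact le_top
  obtain ⟨i₀, h₀r, h₀f, h₀μ, h₀q⟩ := mk (k + 0) (by omega) q hqk
  have hF₀ : i₀.F = i.F := by rw [hF, ← h₀f]; rfl
  have hρ₀ : i₀.ρ = i.ρ := by rw [hρ, ← h₀r]; rfl
  rw [← hρ₀] at hq
  rw [← hF₀, ← hρ₀] at hμs ⊢
  subst h₀f h₀μ h₀q
  have hrep₀ : i₀.Represents := Datum.represents_of_representsDbarSub hq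
  refine ⟨i₀.ν, Datum.sameForm_ν hrep₀ hμs, i₀.isNormalized_ν, ?_, ?_⟩
  · obtain ⟨h1, h2⟩ := hCs 0 (Nat.zero_le k) i₀
    refine ckNorm_le h1 fun j hj z hz => (h2 j hj z hz).trans ?_
    rw [mul_assoc]
    exact mul_le_mul' (hCsC 0 (Nat.zero_le k))
      (tameWeight_le_of_le (Datum.one_le_lowNorm k i₀) hj)
  -- The same ν must satisfy both estimates. It is built from q in C^k; if q is even C^{k+s}, the
  -- datum of that order yields the same function, and otherwise the bound is infinite.
  · by_cases hqs : ContDiffOn ℝ (k + s : ℕ) i₀.q (ball 0 1)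
    swap
    · rw [ckNorm_eq_top hqs, top_add, top_add, top_add, ENNReal.mul_top (hK0 _ _ _)]
      exact le_top
    obtain ⟨i₁, h₁r, h₁f, h₁μ, h₁q⟩ := mk (k + s) (by omega) i₀.q hqs
    have hρ₁ : i₁.ρ = i₀.ρ := by rw [hρ₀, hρ, ← h₁r]; rfl
    have hF₁ : i₁.F = i₀.F := by unfold Datum.F; rw [h₁f]
    have hν₁ : i₁.ν = i₀.ν := by
      funext w
      simp only [Datum.ν, Datum.form, Datum.Φ, Datum.T, hρ₁, hF₁, h₁f, h₁μ, h₁q]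
    rw [← hν₁, ← hF₁, ← hρ₁, ← h₁f, ← h₁μ, ← h₁q]
    obtain ⟨h1, h2⟩ := hCs s hsk i₁
    refine ckNorm_le h1 fun j hj z hz => (h2 j hj z hz).trans ?_
    rw [mul_assoc]
    exact mul_le_mul' (hCsC s hsk) (tameWeight_le hsk (Datum.one_le_lowNorm k i₁)
      (Datum.one_le_lowNorm (k + s) i₁) hj)

end
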